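/- \textbf{Setting.} In the paging problem with $k\ge 1$ servers on a node set $V$, no server is initially on the graph, and a finite sequence $r$ of requests to nodes is served in order. If the requested node has a server, nothing happens; otherwise servers may be removed from their nodes, each at cost $1$, and a server that is not on any node is placed, at no cost, on the requested node (so moving a server costs $1$). A (randomized) paging strategy $X$ is, for each number $k$ of servers, an on-line rule: each (random) choice depends only on the past and on the current request. $\mathrm{cost}(X,k,r)$ is the (expected) cost of $X$ with $k$ servers on $r$, and $\mathrm{cost}(\mathrm{OPT},k,r)$ is the minimum cost of serving $r$ with $k$ servers. A paging strategy is \emph{conservative} if for every $k\ge1$, on every request sequence and for every outcome of its random choices, it moves no server from a node until all $k$ servers have been placed on the graph, and it moves servers at most $k$ times during any block of consecutive requests to at most $k$ distinct nodes. For $c:\{1,2,\dots\}\to(0,\infty)$, $X$ is \emph{loosely $c(k)$-competitive} if there is a constant $b$ such that for every $d>0$ there is a function $g(n)=o(n)$ such that for every $n$ and every request sequence $r$ at most $g(n)$ values $k\in\{1,\dots,n\}$ satisfy \[\mathrm{cost}(X,k,r)\ \ge\ \max\{c(k)\,\mathrm{cost}(\mathrm{OPT},k,r),\ \mathrm{cost}(\mathrm{OPT},1,r)/n^d\}+b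 .\] When a requested node has no server and all $k$ servers are on the graph, LRU moves the server from the least recently requested served node, FIFO moves the least recently moved (or placed) server, FWF removes all $k$ servers (at cost $k$) and then places one on the requested node, and MARK marks all servers if none is marked, and then moves a marked server chosen uniformly at random to the requested node and unmarks it; MARK also unmarks a server whenever its node is requested, and each newly placed server is unmarked. None of them removes a server in any other situation. \textbf{Statement.} Let $c:\{1,2,\dots\}\to(0,\infty)$ be nondecreasing. \begin{enumerate} \item If $k/c(k)$ is nondecreasing and $c(k)/\ln k\to\infty$ as $k\to\infty$, then every conservative paging strategy is loosely $c(k)$-competitive. LRU, FIFO and FWF are conservative, so this applies to them. \item If $2\ln k-c(k)$ is nondecreasing and $c(k)-2\ln\ln k\to\infty$ as $k\to\infty$, then MARK is loosely $c(k)$-competitive. \end{enumerate} -/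

import Mathlib

open Filter Asymptotics
open scoped ENNReal

universe u v

namespace Paging

variable {V : Type u} [DecidableEq V]

/-- One legal step of a cache with `k` slots (`k` servers; a cached node is a node carrying a
server).  A request to a served node changes nothing; otherwise servers may be removed from the
graph, and a free server is placed on the requested node. -/
def Serves (k : ℕ) (C : Finset V) (v : V) (C' : Finset V) : Prop :=
  if v ∈ C then C' = C else v ∈ C' ∧ C' ⊆ insert v C ∧ C'.card ≤ k

/-- The cost of a step: the number of servers moved away from their nodes.  Placing a server that
is not on the graph is free. -/
def evictions (C C' : Finset V) : ℕ := (C \ C').card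

/-- `C` is a (possibly off-line) solution for the request sequence `r` with `k` servers:
`C i` is the set of served nodes before request number `i`. -/
def IsSchedule (k : ℕ) (r : List V) (C : ℕ → Finset V) : Prop :=
  C 0 = ∅ ∧ ∀ (i : ℕ) (h : i < r.length), Serves k (C i) r[i] (C (i + 1))

/-- The minimum cost of serving `r` with `k ≥ 1` servers. -/
noncomputable def opt (k : ℕ) (r : List V) : ℕ :=
  sInf {m | ∃ C, IsSchedule k r C ∧
    m = ∑ i ∈ Finset.range r.length, evictions (C i) (C (i + 1))}

/-- A randomized on-line paging strategy on the node set `V`.  With `k` servers it keeps a memory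
state, and on each request passes to a random new state whose law depends only on the current
state and the request.  Deterministic strategies use `PMF.pure`. -/
structure PagingStrategy (V : Type u) [DecidableEq V] where
  State : ℕ → Type v
  init : (k : ℕ) → State k
  step : (k : ℕ) → State k → V → PMF (State k)
  cache : (k : ℕ) → State k → Finset V
  cache_init : ∀ k, cache k (init k) = ∅
  serves : ∀ k, 0 < k → ∀ s, (cache k s).card ≤ k → ∀ v, ∀ s' ∈ (step k s v).support,
    Serves k (cache k s) v (cache k s')

namespace PagingStrategy

variable (X : PagingStrategy.{u, v} V)

/-- The expected cost of serving the sequence when starting in a given state. -/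
noncomputable def costFrom (k : ℕ) : X.State k → List V → ℝ≥0∞
  | _, [] => 0
  | s, v :: r => ∑' s', X.step k s v s' *
      ((evictions (X.cache k s) (X.cache k s') : ℝ≥0∞) + costFrom k s' r)

/-- The expected cost of `X` with `k` servers on the request sequence `r`. -/
noncomputable def cost (k : ℕ) (r : List V) : ℝ≥0∞ := X.costFrom k (X.init k) r

/-- `σ` is a possible run of `X` with `k` servers on `r`: `σ i` is the state before request number
`i`, and each transition has positive probability. -/
def IsRun (k : ℕ) (r : List V) (σ : ℕ → X.State k) : Prop :=
  σ 0 = X.init k ∧ ∀ (i : ℕ) (h : i < r.length), σ (i + 1) ∈ (X.step k (σ i) r[i]).support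

/-- In every possible run with `k` servers, no server is moved from a node until all `k` servers
have been placed on the graph, and servers are moved at most `k` times during any block of
consecutive requests to at most `k` distinct nodes. -/
def Conservative : Prop :=
  ∀ k, 0 < k → ∀ (r : List V) (σ : ℕ → X.State k), X.IsRun k r σ →
    (∀ i < r.length, 0 < evictions (X.cache k (σ i)) (X.cache k (σ (i + 1))) →
      ∃ j ≤ i, (X.cache k (σ j)).card = k) ∧
    ∀ a b, a ≤ b → b ≤ r.length → ((r.take b).drop a).toFinset.card ≤ k →
      ∑ i ∈ Finset.Ico a b, evictions (X.cache k (σ i)) (X.cache k (σ (i + 1))) ≤ k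

open Classical in
/-- Loose `c(k)`-competitiveness.  All strategies start with no server on the graph, so the
additive term `b` is a constant.  The `o(n)` bound `g` does not depend on `r`. -/
def LooselyCompetitive (c : ℕ → ℝ) : Prop :=
  ∃ b : ℝ, ∀ d : ℝ, 0 < d → ∃ g : ℕ → ℝ, g =o[atTop] (fun n : ℕ => (n : ℝ)) ∧
    ∀ (n : ℕ) (r : List V),
      (((Finset.Icc 1 n).filter fun k =>
        X.cost k r ≥ ENNReal.ofReal
          (max (c k * (opt k r : ℝ)) ((opt 1 r : ℝ) / (n : ℝ) ^ d) + b)).card : ℝ) ≤ g n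

end PagingStrategy

section Strategies

variable (V)

/-- Least recently used.  The state lists the served nodes, most recently requested first. -/
noncomputable def lru : PagingStrategy.{u, u} V where
  State _ := List V
  init _ := []
  step k l v := PMF.pure (if v ∈ l then v :: l.erase v else v :: l.take (k - 1))
  cache _ l := l.toFinset
  cache_init _ := rfl
  serves k hk l _ v l' h := by
    rw [PMF.support_pure, Set.mem_singleton_iff] at h
    subst h
    unfold Serves
    by_cases hv : v ∈ l
    · simp only [hv, List.mem_toFinset, if_true]
      ext x
      by_cases hx : x = v
      · simp [hx, hv]
      · simp [hx, List.mem_erase_of_ne hx]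
    · simp only [hv, List.mem_toFinset, if_false]
      refine ⟨by simp, ?_, (List.toFinset_card_le _).trans ?_⟩
      · intro x hx
        simp only [List.toFinset_cons, Finset.mem_insert, List.mem_toFinset] at hx ⊢
        exact hx.imp_right List.mem_of_mem_take
      · simp only [List.length_cons, List.length_take]
        omega

/-- First in first out.  The state lists the served nodes, the node of the most recently moved (or
placed) server first. -/
noncomputable def fifo : PagingStrategy.{u, u} V where
  State _ := List V
  init _ := []
  step k l v := PMF.pure (if v ∈ l then l else v :: l.take (k - 1))
  cache _ l := l.toFinset
  cache_init _ := rfl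
  serves k hk l _ v l' h := by
    rw [PMF.support_pure, Set.mem_singleton_iff] at h
    subst h
    unfold Serves
    by_cases hv : v ∈ l
    · simp [hv]
    · simp only [hv, List.mem_toFinset, if_false]
      refine ⟨by simp, ?_, (List.toFinset_card_le _).trans ?_⟩
      · intro x hx
        simp only [List.toFinset_cons, Finset.mem_insert, List.mem_toFinset] at hx ⊢
        exact hx.imp_right List.mem_of_mem_take
      · simp only [List.length_cons, List.length_take]
        omega

/-- Flush when full. -/
noncomputable def fwf : PagingStrategy.{u, u} V where
  State _ := Finset V
  init _ := ∅
  step k C v := PMF.pure (if v ∈ C then C else if C.card < k then insert v C else {v})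
  cache _ C := C
  cache_init _ := rfl
  serves k hk C _ v C' h := by
    rw [PMF.support_pure, Set.mem_singleton_iff] at h
    subst h
    unfold Serves
    by_cases hv : v ∈ C
    · simp [hv]
    · by_cases hc : C.card < k
      · simp only [hv, hc, if_true, if_false]
        refine ⟨Finset.mem_insert_self _ _, Finset.Subset.refl _, ?_⟩
        rw [Finset.card_insert_of_notMem hv]
        exact hc
      · simp only [hv, hc, if_false]
        refine ⟨Finset.mem_singleton_self _, ?_, ?_⟩
        · simp
        · rw [Finset.card_singleton]
          exact hk

/-- A state of the marking algorithm: the served nodes, and those of them whose server is marked.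
Servers not yet placed on the graph count as marked and are used first. -/
structure MarkState (V : Type u) where
  cached : Finset V
  marked : Finset V
  sub : marked ⊆ cached

variable {V}

/-- The marked nodes from which a server is drawn at a fault: all servers are marked first if none
is marked. -/
def MarkState.candidates (s : MarkState V) : Finset V :=
  if s.marked = ∅ then s.cached else s.marked

theorem MarkState.candidates_subset (s : MarkState V) : s.candidates ⊆ s.cached := by
  unfold candidates
  split
  · exact Finset.Subset.refl _
  · exact s.sub

/-- The requested node has a server: unmark it. -/
def MarkState.hit (s : MarkState V) (v : V) : MarkState V :=
  ⟨s.cached, s.marked.erase v, (Finset.erase_subset _ _).trans s.sub⟩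

/-- Place a new server on `v`, unmarked. -/
def MarkState.place (s : MarkState V) (v : V) : MarkState V :=
  ⟨insert v s.cached, s.marked, s.sub.trans (Finset.subset_insert _ _)⟩

/-- Move the server on `w` to `v` and unmark it. -/
def MarkState.move (s : MarkState V) (v w : V) : MarkState V :=
  ⟨insert v (s.cached.erase w), s.candidates.erase w,
    (Finset.erase_subset_erase _ s.candidates_subset).trans (Finset.subset_insert _ _)⟩

/-- One step of the marking algorithm with `k` servers (the last branch is reached only if
`k = 0`). -/
noncomputable def MarkState.next (k : ℕ) (s : MarkState V) (v : V) : PMF (MarkState V) :=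
  if v ∈ s.cached then PMF.pure (s.hit v)
  else if s.cached.card < k then PMF.pure (s.place v)
  else if h : s.candidates.Nonempty then (PMF.uniformOfFinset s.candidates h).map (s.move v)
  else PMF.pure s

variable (V)

/-- The randomized marking algorithm. -/
noncomputable def mark : PagingStrategy.{u, u} V where
  State _ := MarkState V
  init _ := ⟨∅, ∅, Finset.Subset.refl _⟩
  step k s v := s.next k v
  cache _ s := s.cached
  cache_init _ := rfl
  serves k hk s hs v s' h := by
    unfold Serves
    unfold MarkState.next at h
    by_cases hv : v ∈ s.cached
    · rw [if_pos hv, PMF.support_pure, Set.mem_singleton_iff] at h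
      subst h
      simp [hv, MarkState.hit]
    · rw [if_neg hv] at h ⊢
      by_cases hc : s.cached.card < k
      · rw [if_pos hc, PMF.support_pure, Set.mem_singleton_iff] at h
        subst h
        simpa [MarkState.place, hv] using hc
      · have hne : s.candidates.Nonempty := by
          unfold MarkState.candidates
          split
          · exact Finset.card_pos.mp (by omega)
          · exact Finset.nonempty_iff_ne_empty.mpr ‹_›
        rw [if_neg hc, dif_pos hne, PMF.mem_support_map_iff] at h
        obtain ⟨w, hw, rfl⟩ := h
        rw [PMF.mem_support_uniformOfFinset_iff] at hw
        have hw' := s.candidates_subset hw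
        refine ⟨Finset.mem_insert_self _ _,
          Finset.insert_subset_insert _ (Finset.erase_subset _ _),
          (Finset.card_insert_le _ _).trans ?_⟩
        rw [Finset.card_erase_of_mem hw']
        have := Finset.card_pos.mpr ⟨w, hw'⟩
        omega

end Strategies

end Paging

/-! Everything rests on comparing the strategy with `k` servers to an optimum with only `h ≤ k`
servers. Cut the requests into phases of `k` distinct nodes. A conservative strategy pays at most
`k` per phase, while `h` servers must be moved at least `k + 1 - h` times in the phase shifted by
one request, so the cost is at most `k / (k + 1 - h)` times `opt h` (`Conservative.cost_le`). MARK,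
in a phase with `m` nodes absent from the previous one, pays at most `m * (1 + log (k / m))` in
expectation. Two consecutive phases contain `k + m` distinct nodes, which forces `k - h + m` moves
on the optimum; linearizing the logarithm gives the factor `2 * ρ` whenever `k ≤ ρ * exp ρ * (k -
h)` (`mark_cost_le`).

Call `k ≤ n` bad if the loose bound fails to hold strictly. Suppose the cost with `k` servers is at
most `c k * exp (-δ) * opt h` as soon as `h + s ≤ k`. If `x` and `y ≤ x - s` are both bad, taking `h
= y` gives `opt x ≤ exp (-δ) * opt y`: the optimum decays geometrically along the bad values. It
cannot decay far, since badness of `x` also gives `opt 1 / n ^ d < c n * opt y`, with `c n ≤ n ^ 2`.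
Hence there are at most about `((d + 2) * log n / δ + 2) * s` bad values
(`looselyCompetitive_of_cost_le`).

For conservative strategies `δ = 1` and `s ≈ e * n / c n` suffice. For MARK one discards `k ≤ ε * n
/ 2` and takes `δ = 1 / c n` and `s ≈ 4 * √e * n * exp (-c n / 2) / c n`. The growth hypotheses on
`c` say precisely that the resulting counts are `o(n)`. -/

namespace Paging

/-! ### Distinct requests in an interval, and phases. -/

section Requests

variable {V : Type u} [DecidableEq V]

/-- The set of nodes requested at the times `a, …, b - 1`. -/
def reqs (r : List V) (a b : ℕ) : Finset V := ((r.take b).drop a).toFinset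

theorem reqs_self (r : List V) (a : ℕ) : reqs r a a = ∅ := by
  simp [reqs, List.drop_eq_nil_of_le]

theorem reqs_succ (r : List V) {a b : ℕ} (hab : a ≤ b) (hb : b < r.length) :
    reqs r a (b + 1) = insert r[b] (reqs r a b) := by
  have hl : a ≤ (r.take b).length := by rw [List.length_take]; omega
  unfold reqs
  rw [← List.take_append_getElem hb, List.drop_append_of_le_length hl, List.toFinset_append]
  ext x
  simp

theorem reqs_left (r : List V) {a b : ℕ} (hab : a < b) (hb : b ≤ r.length) :
    reqs r a b = insert (r[a]'(by omega)) (reqs r (a + 1) b) := by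
  unfold reqs
  rw [List.drop_eq_getElem_cons (by rw [List.length_take]; omega)]
  simp

theorem reqs_mono (r : List V) {a b c : ℕ} (hbc : b ≤ c) : reqs r a b ⊆ reqs r a c := by
  intro x hx
  unfold reqs at *
  rw [List.mem_toFinset] at *
  exact (List.take_sublist_take_left hbc |>.drop a).subset hx

theorem mem_reqs (r : List V) {a b i : ℕ} (hai : a ≤ i) (hib : i < b) (hi : i < r.length) :
    r[i] ∈ reqs r a b := by
  apply reqs_mono r (Nat.succ_le_of_lt hib)
  rw [Nat.succ_eq_add_one, reqs_succ r hai hi]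
  exact Finset.mem_insert_self _ _

theorem reqs_union (r : List V) {a b c : ℕ} (hab : a ≤ b) (hbc : b ≤ c) :
    reqs r a c = reqs r a b ∪ reqs r b c := by
  unfold reqs
  rw [← List.toFinset_append]
  congr 1
  rw [List.drop_take, List.drop_take, List.drop_take]
  have h : c - a = (b - a) + (c - b) := by omega
  rw [h, List.take_add, List.drop_drop]
  congr 3
  omega

/-- If more than `k` distinct nodes are requested from time `a` on, then some time `b` starts a new
phase: exactly `k` distinct nodes are requested in `[a, b)`, and `r[b]` is none of them. -/
theorem exists_phase_end (r : List V) (k a : ℕ) (ha : a ≤ r.length)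
    (h : k < (reqs r a r.length).card) :
    ∃ b, ∃ hb : b < r.length, a ≤ b ∧ (reqs r a b).card = k ∧ r[b] ∉ reqs r a b := by
  classical
  have hex : ∃ e, a ≤ e ∧ e ≤ r.length ∧ k < (reqs r a e).card := ⟨r.length, ha, le_rfl, h⟩
  obtain ⟨h1, h2, h3⟩ := Nat.find_spec hex
  have hmin := fun m => Nat.find_min hex (m := m)
  generalize Nat.find hex = e at h1 h2 h3 hmin
  have hae : a < e := by
    rcases h1.lt_or_eq with h | h
    · exact h
    · subst h
      simp [reqs_self] at h3
  obtain ⟨b, rfl⟩ : ∃ b, e = b + 1 := ⟨e - 1, by omega⟩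
  have hb : b < r.length := by omega
  have hle : (reqs r a b).card ≤ k := by
    by_contra hc
    exact hmin b (by omega) ⟨by omega, by omega, by omega⟩
  have hn : r[b] ∉ reqs r a b := by
    intro hm
    rw [reqs_succ r (by omega) hb, Finset.insert_eq_of_mem hm] at h3
    omega
  refine ⟨b, hb, by omega, ?_, hn⟩
  rw [reqs_succ r (by omega) hb, Finset.card_insert_of_notMem hn] at h3
  omega

end Requests

/-! ### Lower bounds for the optimum. -/

section Opt

variable {V : Type u} [DecidableEq V]

theorem Serves.mem {k : ℕ} {C C' : Finset V} {v : V} (h : Serves k C v C') : v ∈ C' := by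
  unfold Serves at h
  split at h
  · rwa [h]
  · exact h.1

theorem Serves.subset {k : ℕ} {C C' : Finset V} {v : V} (h : Serves k C v C') :
    C' ⊆ insert v C := by
  unfold Serves at h
  split at h
  · rw [h]; exact Finset.subset_insert _ _
  · exact h.2.1

theorem Serves.card_le {k : ℕ} {C C' : Finset V} {v : V} (h : Serves k C v C')
    (hC : C.card ≤ k) : C'.card ≤ k := by
  unfold Serves at h
  split at h
  · rwa [h]
  · exact h.2.2

theorem Serves.mono {k l : ℕ} (hkl : k ≤ l) {C C' : Finset V} {v : V} (h : Serves k C v C') :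
    Serves l C v C' := by
  unfold Serves at *
  split at h
  · rw [if_pos ‹_›]; exact h
  · rw [if_neg ‹_›]; exact ⟨h.1, h.2.1, h.2.2.trans hkl⟩

theorem Serves.evictions_eq_zero {k : ℕ} {C C' : Finset V} {v : V} (h : Serves k C v C')
    (hv : v ∈ C) : evictions C C' = 0 := by
  unfold Serves at h
  rw [if_pos hv] at h
  simp [evictions, h]

/-- A single server following the requests is a legal schedule. This matters because `sInf ∅ = 0` in
`ℕ`, so `opt` is a genuine minimum only once some schedule exists. -/
theorem exists_isSchedule {k : ℕ} (hk : 0 < k) (r : List V) : ∃ C, IsSchedule k r C := by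
  refine ⟨fun i => match i with
    | 0 => ∅
    | i + 1 => if h : i < r.length then {r[i]} else ∅, rfl, fun i hi => ?_⟩
  unfold Serves
  cases i with
  | zero => simp [hi]; omega
  | succ j =>
    have hj : j < r.length := by omega
    simp only [hi, hj, dite_true, Finset.mem_singleton]
    split
    · rename_i h; rw [h]
    · simp; omega

theorem exists_opt_schedule {k : ℕ} (hk : 0 < k) (r : List V) :
    ∃ C, IsSchedule k r C ∧
      opt k r = ∑ i ∈ Finset.range r.length, evictions (C i) (C (i + 1)) := by
  obtain ⟨C, hC⟩ := exists_isSchedule hk r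
  exact Nat.sInf_mem (s := {m | ∃ C, IsSchedule k r C ∧
    m = ∑ i ∈ Finset.range r.length, evictions (C i) (C (i + 1))}) ⟨_, C, hC, rfl⟩

theorem opt_anti {k l : ℕ} (hk : 0 < k) (hkl : k ≤ l) (r : List V) : opt l r ≤ opt k r := by
  obtain ⟨C, hC, h⟩ := exists_opt_schedule hk r
  exact Nat.sInf_le ⟨C, ⟨hC.1, fun i hi => (hC.2 i hi).mono hkl⟩, h⟩

/-- Any nodes served at time `a` or requested in `[a, e)` are still served at time `e`, or their
server has been removed in between. -/
theorem card_union_reqs_le {k : ℕ} {r : List V} {C : ℕ → Finset V}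
    (hC : ∀ (i : ℕ) (h : i < r.length), Serves k (C i) r[i] (C (i + 1))) {a e : ℕ}
    (hae : a ≤ e) (he : e ≤ r.length) :
    ((C a ∪ reqs r a e) \ C e).card ≤ ∑ i ∈ Finset.Ico a e, evictions (C i) (C (i + 1)) := by
  induction e, hae using Nat.le_induction with
  | base => simp [reqs_self]
  | succ e hae ih =>
    rw [Finset.sum_Ico_succ_top hae]
    refine le_trans ?_ (Nat.add_le_add_right (ih (by omega)) _)
    unfold evictions
    refine le_trans (Finset.card_le_card ?_) (Finset.card_union_le _ _)
    intro x hx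
    have hm := (hC e he).mem
    rw [reqs_succ r hae he] at hx
    simp only [Finset.mem_sdiff, Finset.mem_union, Finset.mem_insert] at hx ⊢
    by_cases hxe : x ∈ C e
    · exact Or.inr ⟨hxe, hx.2⟩
    · left
      refine ⟨?_, hxe⟩
      rcases hx.1 with h | rfl | h
      · exact Or.inl h
      · exact absurd hm hx.2
      · exact Or.inr h

theorem IsSchedule.card_le {k : ℕ} {r : List V} {C : ℕ → Finset V} (hC : IsSchedule k r C)
    {i : ℕ} (hi : i ≤ r.length) : (C i).card ≤ k := by
  induction i with
  | zero => simp [hC.1]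
  | succ i ih => exact (hC.2 i hi).card_le (ih (by omega))

/-- The cumulative cost `E` of an optimal solution: while serving the requests in `[a, e)`, at
least `|reqs r a e| - h` servers are moved after request `a`. -/
theorem exists_opt_profile {h : ℕ} (hh : 0 < h) (r : List V) :
    ∃ E : ℕ → ℕ, Monotone E ∧ E r.length = opt h r ∧
      ∀ a e, a < e → e ≤ r.length → (reqs r a e).card + E (a + 1) ≤ h + E e := by
  obtain ⟨C, hC, hopt⟩ := exists_opt_schedule hh r
  refine ⟨fun j => ∑ i ∈ Finset.range j, evictions (C i) (C (i + 1)), ?_, hopt.symm, ?_⟩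
  · intro i j hij
    exact Finset.sum_le_sum_of_subset (Finset.range_mono hij)
  · intro a e hae he
    have h1 := card_union_reqs_le hC.2 (a := a + 1) (e := e) hae he
    -- Request `a` leaves `r[a]` served at time `a + 1`. So counting moves only from `a + 1` on
    -- still accounts for all nodes of `reqs r a e`.
    have h2 : reqs r a e ⊆ C (a + 1) ∪ reqs r (a + 1) e := by
      rw [reqs_left r hae he]
      intro x hx
      rw [Finset.mem_insert] at hx
      rcases hx with rfl | hx
      · exact Finset.mem_union_left _ (hC.2 a (by omega)).mem
      · exact Finset.mem_union_right _ hx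
    have h3 := Finset.card_le_card h2
    have h4 := Finset.le_card_sdiff (C e) (C (a + 1) ∪ reqs r (a + 1) e)
    have h5 := hC.card_le he
    have h6 := Finset.sum_range_add_sum_Ico (fun i => evictions (C i) (C (i + 1))) hae
    simp only [Nat.succ_eq_add_one] at h6 ⊢
    omega

end Opt

/-! ### Conservative strategies against an optimum with fewer servers. -/

section Conservative

variable {V : Type u} [DecidableEq V] {X : PagingStrategy.{u, v} V}

theorem PagingStrategy.costFrom_le {k : ℕ} (r : List V) (s : X.State k) (M : ℕ)
    (h : ∀ σ : ℕ → X.State k, σ 0 = s →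
      (∀ (i : ℕ) (h : i < r.length), σ (i + 1) ∈ (X.step k (σ i) r[i]).support) →
      ∑ i ∈ Finset.range r.length, evictions (X.cache k (σ i)) (X.cache k (σ (i + 1))) ≤ M) :
    X.costFrom k s r ≤ M := by
  induction r generalizing s M with
  | nil => simp [PagingStrategy.costFrom]
  | cons v r ih =>
    have hrun : ∀ (r : List V) (s : X.State k), ∃ σ : ℕ → X.State k, σ 0 = s ∧
        ∀ (i : ℕ) (h : i < r.length), σ (i + 1) ∈ (X.step k (σ i) r[i]).support := by
      intro r
      induction r with
      | nil => exact fun s => ⟨fun _ => s, rfl, by simp⟩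
      | cons v r ih =>
        intro s
        obtain ⟨s', hs'⟩ := (X.step k s v).support_nonempty
        obtain ⟨σ, h0, hσ⟩ := ih s'
        refine ⟨fun i => i.casesOn s σ, rfl, fun i hi => ?_⟩
        cases i with
        | zero => simpa [h0] using hs'
        | succ i => simpa using hσ i (by simpa using hi)
    have key : ∀ s' ∈ (X.step k s v).support,
        (evictions (X.cache k s) (X.cache k s') : ℝ≥0∞) + X.costFrom k s' r ≤ M := by
      intro s' hs'
      have hstep : ∀ σ : ℕ → X.State k, σ 0 = s' →
          (∀ (i : ℕ) (h : i < r.length), σ (i + 1) ∈ (X.step k (σ i) r[i]).support) →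
          ∑ i ∈ Finset.range r.length, evictions (X.cache k (σ i)) (X.cache k (σ (i + 1)))
            + evictions (X.cache k s) (X.cache k s') ≤ M := by
        intro σ h0 hσ
        have := h (fun i => i.casesOn s σ) rfl ?_
        · rw [List.length_cons, Finset.sum_range_succ'] at this
          simpa [h0] using this
        · intro i hi
          cases i with
          | zero => simpa [h0] using hs'
          | succ i => simpa using hσ i (by simpa using hi)
      -- Some run continues from `s'`, so this step alone costs at most `M` and the truncated
      -- subtraction below is exact.
      obtain ⟨σ, h0, hσ⟩ := hrun r s'
      have hle := hstep σ h0 hσ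
      have := ih s' (M - evictions (X.cache k s) (X.cache k s')) fun σ h0 hσ => by
        have := hstep σ h0 hσ
        omega
      refine (add_le_add_right this _).trans ?_
      rw [← Nat.cast_add]
      exact_mod_cast (show _ + (M - _) ≤ M by omega)
    rw [PagingStrategy.costFrom]
    calc _ ≤ ∑' s', X.step k s v s' * (M : ℝ≥0∞) := by
          refine ENNReal.tsum_le_tsum fun s' => ?_
          by_cases hs' : s' ∈ (X.step k s v).support
          · exact mul_le_mul_right (key s' hs') _
          · rw [PMF.mem_support_iff, not_not] at hs'
            simp [hs']
      _ = M := by rw [ENNReal.tsum_mul_right, PMF.tsum_coe, one_mul]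

namespace PagingStrategy

theorem IsRun.serves {k : ℕ} (hk : 0 < k) {r : List V} {σ : ℕ → X.State k}
    (hσ : X.IsRun k r σ) {i : ℕ} (hi : i ≤ r.length) :
    (X.cache k (σ i)).card ≤ k ∧ X.cache k (σ i) ⊆ reqs r 0 i ∧
      ∀ h : i < r.length, Serves k (X.cache k (σ i)) r[i] (X.cache k (σ (i + 1))) := by
  induction i with
  | zero =>
    rw [hσ.1, X.cache_init]
    refine ⟨by simp, by simp, fun h => ?_⟩
    have := X.serves k hk (σ 0) (by simp [hσ.1, X.cache_init]) r[0] _ (hσ.2 0 h)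
    rwa [hσ.1, X.cache_init] at this
  | succ i ih =>
    obtain ⟨h1, h2, h3⟩ := ih (by omega)
    have h4 := (h3 hi).card_le h1
    refine ⟨h4, ?_, fun h => X.serves k hk _ h4 _ _ (hσ.2 _ h)⟩
    rw [reqs_succ r (Nat.zero_le _) hi]
    exact (h3 hi).subset.trans (Finset.insert_subset_insert _ h2)

/-- A move requires that all `k` servers have been placed, and they stand on requested nodes. With
at most `k` distinct requests the cache then contains every node still to be requested, so no fault
can occur. -/
theorem Conservative.sum_first_phase (hX : X.Conservative) {k : ℕ} (hk : 0 < k) {r : List V}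
    {σ : ℕ → X.State k} (hσ : X.IsRun k r σ) {b : ℕ} (hb : b ≤ r.length)
    (hcard : (reqs r 0 b).card ≤ k) :
    ∑ i ∈ Finset.range b, evictions (X.cache k (σ i)) (X.cache k (σ (i + 1))) = 0 := by
  refine Finset.sum_eq_zero fun i hi => ?_
  rw [Finset.mem_range] at hi
  by_contra hne
  obtain ⟨j, hji, hj⟩ := (hX k hk r σ hσ).1 i (by omega) (Nat.pos_of_ne_zero hne)
  have hfull : ∀ l, j ≤ l → l ≤ i → X.cache k (σ l) = reqs r 0 b := by
    intro l hjl
    induction l, hjl using Nat.le_induction with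
    | base =>
      intro _
      exact Finset.eq_of_subset_of_card_le
        ((hσ.serves hk (by omega)).2.1.trans (reqs_mono r (by omega))) (by omega)
    | succ l hjl ih =>
      intro hl
      have h1 := ih (by omega)
      have hl' : l < r.length := by omega
      have h2 := (hσ.serves hk hl'.le).2.2 hl'
      unfold Serves at h2
      rwa [h1, if_pos (mem_reqs r (Nat.zero_le _) (by omega) hl')] at h2
  have hi' : i < r.length := by omega
  refine hne (((hσ.serves hk hi'.le).2.2 hi').evictions_eq_zero ?_)
  rw [hfull i hji le_rfl]
  exact mem_reqs r (Nat.zero_le _) hi hi'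

/-- With `h ≤ k`, each phase of a conservative strategy costs at most `k`, while the optimum for
`h` servers moves at least `k + 1 - h` servers in the shifted phase. -/
theorem Conservative.sum_le_of_profile (hX : X.Conservative) {k h : ℕ} (hh : 0 < h) (hhk : h ≤ k)
    {r : List V} {σ : ℕ → X.State k} (hσ : X.IsRun k r σ) {E : ℕ → ℕ} (hmono : Monotone E)
    (hE : ∀ a e, a < e → e ≤ r.length → (reqs r a e).card + E (a + 1) ≤ h + E e)
    (a : ℕ) (ha : a < r.length) :
    (k + 1 - h) * ∑ i ∈ Finset.Ico a r.length,
      evictions (X.cache k (σ i)) (X.cache k (σ (i + 1))) + k * E (a + 1)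
        ≤ k * (k + 1 - h) + k * E r.length := by
  have hk : 0 < k := by omega
  induction _hn : r.length - a using Nat.strong_induction_on generalizing a with
  | _ n ih =>
    by_cases hc : (reqs r a r.length).card ≤ k
    · have h1 := (hX k hk r σ hσ).2 a r.length ha.le le_rfl hc
      have h2 := hmono (show a + 1 ≤ r.length from ha)
      rw [mul_comm k (k + 1 - h)]
      exact add_le_add (Nat.mul_le_mul_left _ h1) (Nat.mul_le_mul_left _ h2)
    · obtain ⟨b, hb, hab, hcard, hnot⟩ := exists_phase_end r k a ha.le (by omega)
      have hlt : a < b := by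
        rcases hab.lt_or_eq with h | h
        · exact h
        · subst h
          simp [reqs_self] at hcard
          omega
      have h1 := ih (r.length - b) (by omega) b hb rfl
      have h2 := (hX k hk r σ hσ).2 a b hab hb.le hcard.le
      have h3 := hE a (b + 1) (by omega) hb
      rw [reqs_succ r hab hb, Finset.card_insert_of_notMem hnot, hcard] at h3
      rw [← Finset.sum_Ico_consecutive _ hab hb.le]
      -- The interval `[a, b + 1)` has `k + 1` distinct nodes. Charging to `[a + 1, b + 1)` makes
      -- the charges of successive phases disjoint; only the last, possibly incomplete, phase
      -- remains for the additive `k * (k + 1 - h)`.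
      have h4 : k + 1 - h + E (a + 1) ≤ E (b + 1) := by omega
      have h5 := Nat.mul_le_mul_left k h4
      have h6 := Nat.mul_le_mul_left (k + 1 - h) h2
      rw [mul_add] at h5 ⊢
      rw [mul_comm (k + 1 - h) k] at h6
      omega

theorem Conservative.cost_le (hX : X.Conservative) {k h : ℕ} (hh : 0 < h) (hhk : h ≤ k)
    (r : List V) :
    X.cost k r ≤ ENNReal.ofReal ((k : ℝ) / (k + 1 - h) * opt h r) := by
  have hk : 0 < k := by omega
  have hrun : ∀ σ : ℕ → X.State k, X.IsRun k r σ →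
      (k + 1 - h) * ∑ i ∈ Finset.range r.length,
        evictions (X.cache k (σ i)) (X.cache k (σ (i + 1))) ≤ k * opt h r := by
    intro σ hσ
    by_cases hc : (reqs r 0 r.length).card ≤ k
    · rw [hX.sum_first_phase hk hσ le_rfl hc]
      simp
    · obtain ⟨E, hmono, hlen, hE⟩ := exists_opt_profile hh r
      obtain ⟨b, hb, -, hcard, hnot⟩ := exists_phase_end r k 0 (Nat.zero_le _) (by omega)
      have h1 := hX.sum_le_of_profile hh hhk hσ hmono hE b hb
      have h2 := hX.sum_first_phase hk hσ hb.le hcard.le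
      have h3 := hE 0 (b + 1) (by omega) hb
      rw [reqs_succ r (Nat.zero_le _) hb, Finset.card_insert_of_notMem hnot, hcard] at h3
      rw [← Finset.sum_range_add_sum_Ico _ hb.le, h2, zero_add, ← hlen]
      -- The first phase is free for `X` but not for the optimum; this surplus absorbs the additive
      -- term left by the last phase.
      have h4 : k + 1 - h ≤ E (b + 1) := by omega
      have h5 := Nat.mul_le_mul_left k h4
      omega
  have hpos : 0 < k + 1 - h := by omega
  refine (costFrom_le r (X.init k) (k * opt h r / (k + 1 - h)) fun σ h0 hσ => ?_).trans ?_
  · rw [Nat.le_div_iff_mul_le hpos, mul_comm]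
    exact hrun σ ⟨h0, hσ⟩
  · rw [← ENNReal.ofReal_natCast]
    refine ENNReal.ofReal_le_ofReal (Nat.cast_div_le.trans (le_of_eq ?_))
    rw [Nat.cast_sub (by omega)]
    push_cast
    ring

end PagingStrategy

end Conservative

/-! ### LRU, FIFO and FWF are conservative. -/

section Deterministic

variable {V : Type u} [DecidableEq V]

/-- Guarantees that `take (k - 1)` at a fault on `v` keeps the whole front part `p` of nodes
requested in the current block. -/
theorem card_le_of_append {l p s : List V} {D : Finset V} {v : V} {k : ℕ} (hl : l = p ++ s)
    (hn : l.Nodup) (hp : p.toFinset ⊆ D) (hv : v ∉ l) (hD : (insert v D).card ≤ k) :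
    p.length ≤ k - 1 := by
  subst hl
  have h1 : (insert v p.toFinset).card ≤ k :=
    (Finset.card_le_card (Finset.insert_subset_insert _ hp)).trans hD
  rw [Finset.card_insert_of_notMem (by simp at hv ⊢; exact hv.1),
    List.toFinset_card_of_nodup (List.nodup_append.1 hn).1] at h1
  omega

theorem evictions_take_le {l : List V} (v : V) {k : ℕ} (hl : l.length ≤ k) :
    evictions l.toFinset (v :: l.take (k - 1)).toFinset ≤ 1 := by
  unfold evictions
  calc _ ≤ (l.drop (k - 1)).toFinset.card := by
        refine Finset.card_le_card fun x hx => ?_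
        rw [Finset.mem_sdiff, List.mem_toFinset, List.mem_toFinset] at hx
        rw [List.mem_toFinset]
        have h := hx.1
        rw [← List.take_append_drop (k - 1) l, List.mem_append] at h
        exact h.resolve_left fun h => hx.2 (List.mem_cons_of_mem _ h)
    _ ≤ _ := by
        refine (List.toFinset_card_le _).trans ?_
        rw [List.length_drop]
        omega

/-- A strategy that keeps a list of the served nodes, does not lose nodes from a front part of the
list on a hit, and drops only the last node on a fault, is conservative. -/
theorem conservative_of_list {X : PagingStrategy.{u, u} V} (hS : ∀ k, X.State k = List V)
    (step : List V → V → List V)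
    (hinit : ∀ k, cast (hS k) (X.init k) = [])
    (hcache : ∀ k s, X.cache k s = (cast (hS k) s).toFinset)
    (hstep : ∀ k s v, ∀ s' ∈ (X.step k s v).support, cast (hS k) s' =
      if v ∈ cast (hS k) s then step (cast (hS k) s) v
      else v :: (cast (hS k) s).take (k - 1))
    (hperm : ∀ l v, v ∈ l → (step l v).Perm l)
    (hfront : ∀ p s v, (p ++ s).Nodup → v ∈ p ++ s → ∃ p' s', step (p ++ s) v = p' ++ s' ∧
      p.length ≤ p'.length ∧ p'.toFinset ⊆ insert v p.toFinset) :
    X.Conservative := by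
  intro k hk r σ hσ
  have hinv : ∀ i, i ≤ r.length →
      (cast (hS k) (σ i)).Nodup ∧ (cast (hS k) (σ i)).length ≤ k := by
    intro i
    induction i with
    | zero =>
      intro _
      rw [hσ.1, hinit]
      simp
    | succ i ih =>
      intro hi
      obtain ⟨h1, h2⟩ := ih (by omega)
      rw [hstep k _ _ _ (hσ.2 i hi)]
      split
      · rename_i hm
        have hp := hperm _ _ hm
        exact ⟨hp.nodup_iff.2 h1, hp.length_eq.trans_le h2⟩
      · rename_i hm
        refine ⟨List.nodup_cons.2 ⟨fun h => hm (List.mem_of_mem_take h),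
          h1.sublist (List.take_sublist _ _)⟩, ?_⟩
        simp only [List.length_cons, List.length_take]
        omega
  have hev : ∀ i (hi : i < r.length), r[i] ∈ cast (hS k) (σ i) →
      evictions (X.cache k (σ i)) (X.cache k (σ (i + 1))) = 0 := by
    intro i hi hm
    exact ((hσ.serves hk hi.le).2.2 hi).evictions_eq_zero (by rwa [hcache, List.mem_toFinset])
  refine ⟨fun i hi hpos => ⟨i, le_rfl, ?_⟩, fun a b hab hb hcard => ?_⟩
  · obtain ⟨h1, h2⟩ := hinv i hi.le
    rw [hcache, List.toFinset_card_of_nodup h1]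
    by_contra hne
    have hm : r[i] ∉ cast (hS k) (σ i) := fun hm => by
      rw [hev i hi hm] at hpos
      omega
    rw [hcache, hcache, hstep k _ _ _ (hσ.2 i hi), if_neg hm,
      List.take_of_length_le (by omega)] at hpos
    unfold evictions at hpos
    rw [List.toFinset_cons, Finset.sdiff_eq_empty_iff_subset.2 (Finset.subset_insert _ _)] at hpos
    simp at hpos
  · have hcard' : (reqs r a b).card ≤ k := hcard
    -- The front part `p` holds only nodes requested since `a`, and its length dominates the moves
    -- since `a`: each fault prolongs it by one and moves at most one server. As `p` has no
    -- repetitions, its length is at most the number of distinct requests.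
    have key : ∀ e, a ≤ e → e ≤ b → ∃ p s, cast (hS k) (σ e) = p ++ s ∧
        p.toFinset ⊆ reqs r a e ∧
        ∑ i ∈ Finset.Ico a e, evictions (X.cache k (σ i)) (X.cache k (σ (i + 1))) ≤ p.length := by
      intro e hae
      induction e, hae using Nat.le_induction with
      | base => exact fun _ => ⟨[], _, rfl, by simp, by simp⟩
      | succ e hae ih =>
        intro heb
        have he : e < r.length := by omega
        obtain ⟨p, s, h1, h2, h3⟩ := ih (by omega)
        rw [Finset.sum_Ico_succ_top hae, reqs_succ r hae he, hstep k _ _ _ (hσ.2 e he)]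
        have hnd := (hinv e he.le).1
        by_cases hm : r[e] ∈ cast (hS k) (σ e)
        · rw [if_pos hm, hev e he hm, h1]
          rw [h1] at hnd hm
          obtain ⟨p', s', h4, h5, h6⟩ := hfront p s r[e] hnd hm
          exact ⟨p', s', h4, h6.trans (Finset.insert_subset_insert _ h2), by omega⟩
        · have hle := card_le_of_append h1 hnd h2 hm (k := k) (by
            rw [← reqs_succ r hae he]
            exact (Finset.card_le_card (reqs_mono r heb)).trans hcard')
          have h4 := evictions_take_le r[e] (hinv e he.le).2
          rw [if_neg hm]
          refine ⟨r[e] :: p, s.take (k - 1 - p.length), ?_, ?_, ?_⟩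
          · rw [h1, List.take_append, List.take_of_length_le hle, List.cons_append]
          · rw [List.toFinset_cons]
            exact Finset.insert_subset_insert _ h2
          · rw [hcache k (σ (e + 1)), hstep k _ _ _ (hσ.2 e he), if_neg hm, hcache,
              List.length_cons]
            omega
    obtain ⟨p, s, h1, h2, h3⟩ := key b hab le_rfl
    have hnd := (hinv b hb).1
    rw [h1] at hnd
    have h4 := List.toFinset_card_of_nodup (List.nodup_append.1 hnd).1
    exact h3.trans (h4.symm.trans_le ((Finset.card_le_card h2).trans hcard'))

theorem lru_conservative : (lru V).Conservative := by
  refine conservative_of_list (fun _ => rfl) (fun l v => v :: l.erase v) (fun _ => rfl)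
    (fun _ _ => rfl) ?_ ?_ ?_
  · intro k s v s' hs'
    exact (PMF.mem_support_pure_iff _ _).1 hs'
  · intro l v hv
    exact (List.perm_cons_erase hv).symm
  · intro p s v hn hv
    by_cases hp : v ∈ p
    · refine ⟨v :: p.erase v, s, by simp [List.erase_append, hp], ?_, ?_⟩
      · exact (List.perm_cons_erase hp).length_eq.le
      · intro x hx
        simp only [List.toFinset_cons, Finset.mem_insert, List.mem_toFinset] at hx ⊢
        exact hx.imp_right List.mem_of_mem_erase
    · refine ⟨v :: p, s.erase v, by simp [List.erase_append, hp], by simp, by simp⟩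

theorem fifo_conservative : (fifo V).Conservative := by
  refine conservative_of_list (fun _ => rfl) (fun l _ => l) (fun _ => rfl)
    (fun _ _ => rfl) ?_ ?_ ?_
  · intro k s v s' hs'
    exact (PMF.mem_support_pure_iff _ _).1 hs'
  · exact fun l v _ => List.Perm.refl l
  · exact fun p s v _ _ => ⟨p, s, rfl, le_rfl, Finset.subset_insert _ _⟩

theorem fwf_conservative : (fwf V).Conservative := by
  intro k hk r σ hσ
  let C : ℕ → Finset V := σ
  change (∀ i < r.length, 0 < evictions (C i) (C (i + 1)) → ∃ j ≤ i, (C j).card = k) ∧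
    ∀ a b, a ≤ b → b ≤ r.length → (reqs r a b).card ≤ k →
      ∑ i ∈ Finset.Ico a b, evictions (C i) (C (i + 1)) ≤ k
  have hstep : ∀ i (hi : i < r.length), C (i + 1) =
      if r[i] ∈ C i then C i else if (C i).card < k then insert r[i] (C i) else {r[i]} :=
    fun i hi => (PMF.mem_support_pure_iff _ _).1 (hσ.2 i hi)
  have hcard : ∀ i, i ≤ r.length → (C i).card ≤ k := fun i hi => (hσ.serves hk hi).1
  have hzero : ∀ i (hi : i < r.length), (r[i] ∈ C i ∨ (C i).card < k) →
      C i ⊆ C (i + 1) ∧ C (i + 1) ⊆ insert r[i] (C i) ∧ evictions (C i) (C (i + 1)) = 0 := by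
    intro i hi h
    have hs : C i ⊆ C (i + 1) ∧ C (i + 1) ⊆ insert r[i] (C i) := by
      rw [hstep i hi]
      split
      · exact ⟨subset_rfl, Finset.subset_insert _ _⟩
      · rw [if_pos (h.resolve_left ‹_›)]
        exact ⟨Finset.subset_insert _ _, subset_rfl⟩
    exact ⟨hs.1, hs.2, by rw [evictions, Finset.sdiff_eq_empty_iff_subset.2 hs.1]; rfl⟩
  refine ⟨fun i hi hpos => ⟨i, le_rfl, ?_⟩, fun a b hab hb hab' => ?_⟩
  · by_contra hne
    rw [(hzero i hi (Or.inr (lt_of_le_of_ne (hcard i hi.le) hne))).2.2] at hpos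
    omega
  · have key : ∀ e, a ≤ e → e ≤ b →
        ∑ i ∈ Finset.Ico a e, evictions (C i) (C (i + 1)) = 0 ∨
        C e ⊆ reqs r a e ∧ ∑ i ∈ Finset.Ico a e, evictions (C i) (C (i + 1)) ≤ k := by
      intro e hae
      induction e, hae using Nat.le_induction with
      | base => simp
      | succ e hae ih =>
        intro heb
        have he : e < r.length := by omega
        rw [Finset.sum_Ico_succ_top hae, reqs_succ r hae he]
        by_cases h : r[e] ∈ C e ∨ (C e).card < k
        · obtain ⟨-, h1, h2⟩ := hzero e he h
          rw [h2, add_zero]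
          exact (ih (by omega)).imp_right fun h3 =>
            ⟨h1.trans (Finset.insert_subset_insert _ h3.1), h3.2⟩
        · rw [not_or] at h
          right
          rcases ih (by omega) with h1 | ⟨h1, -⟩
          · rw [h1, hstep e he, if_neg h.1, if_neg h.2, zero_add]
            refine ⟨by simp, (Finset.card_le_card Finset.sdiff_subset).trans (hcard e he.le)⟩
          · exfalso
            have h2 := Finset.card_le_card (Finset.insert_subset_insert r[e] h1)
            rw [Finset.card_insert_of_notMem h.1, ← reqs_succ r hae he] at h2
            have h3 := Finset.card_le_card (reqs_mono r (a := a) heb)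
            omega
    rcases key b hab le_rfl with h | h
    · omega
    · exact h.2

end Deterministic

/-! ### Expectations under point, image and uniform laws. -/

section PMF

variable {α β : Type*}

theorem tsum_pure_mul (a : α) (g : α → ℝ≥0∞) : ∑' x, PMF.pure a x * g x = g a := by
  rw [tsum_eq_single a]
  · simp
  · intro b hb
    simp [PMF.pure_apply, hb]

theorem tsum_map_mul (p : PMF α) (f : α → β) (g : β → ℝ≥0∞) :
    ∑' y, p.map f y * g y = ∑' x, p x * g (f x) := by
  classical
  simp_rw [PMF.map_apply, ← ENNReal.tsum_mul_right]
  rw [ENNReal.tsum_comm]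
  refine tsum_congr fun x => ?_
  rw [tsum_eq_single (f x)]
  · simp
  · intro y hy
    simp [hy]

theorem tsum_uniformOfFinset_mul (s : Finset α) (hs : s.Nonempty) (g : α → ℝ≥0∞) :
    ∑' x, PMF.uniformOfFinset s hs x * g x = (s.card : ℝ≥0∞)⁻¹ * ∑ x ∈ s, g x := by
  rw [tsum_eq_sum (s := s), Finset.mul_sum]
  · refine Finset.sum_congr rfl fun x hx => ?_
    rw [PMF.uniformOfFinset_apply_of_mem hs hx]
  · intro x hx
    rw [PMF.uniformOfFinset_apply_of_notMem hs hx, zero_mul]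

end PMF

/-! ### Averages over subsets of fixed size. -/

section PowersetCard

variable {α : Type*} [DecidableEq α]

/-- Double counting: each `t`-subset arises by erasing `x` from a `(t + 1)`-subset in `O.card - t`
ways, one for each `x` outside it. Thus erasing a uniform element of a uniform subset leaves a
uniform subset. -/
theorem sum_powersetCard_sum_erase (O : Finset α) (t : ℕ) (f : Finset α → ℝ≥0∞) :
    ∑ M ∈ O.powersetCard (t + 1), ∑ x ∈ M, f (M.erase x)
      = ((O.card - t : ℕ) : ℝ≥0∞) * ∑ M ∈ O.powersetCard t, f M := by
  have h : ∀ M ∈ O.powersetCard t, ((O.card - t : ℕ) : ℝ≥0∞) * f M = ∑ _x ∈ O \ M, f M := by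
    intro M hM
    rw [Finset.mem_powersetCard] at hM
    rw [Finset.sum_const, Finset.card_sdiff_of_subset hM.1, hM.2, nsmul_eq_mul]
  rw [Finset.mul_sum, Finset.sum_congr rfl h, Finset.sum_sigma', Finset.sum_sigma']
  refine Finset.sum_nbij' (fun p => ⟨p.1.erase p.2, p.2⟩) (fun p => ⟨insert p.2 p.1, p.2⟩)
    ?_ ?_ ?_ ?_ ?_
  · rintro ⟨M, x⟩ hp
    simp only [Finset.mem_sigma, Finset.mem_powersetCard, Finset.mem_sdiff] at hp ⊢
    refine ⟨⟨(Finset.erase_subset _ _).trans hp.1.1, ?_⟩, hp.1.1 hp.2, Finset.notMem_erase _ _⟩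
    rw [Finset.card_erase_of_mem hp.2]
    omega
  · rintro ⟨M, x⟩ hp
    simp only [Finset.mem_sigma, Finset.mem_powersetCard, Finset.mem_sdiff] at hp ⊢
    refine ⟨⟨Finset.insert_subset hp.2.1 hp.1.1, ?_⟩, Finset.mem_insert_self _ _⟩
    rw [Finset.card_insert_of_notMem hp.2.2, hp.1.2]
  · rintro ⟨M, x⟩ hp
    simp only [Finset.mem_sigma] at hp
    simp [Finset.insert_erase hp.2]
  · rintro ⟨M, x⟩ hp
    simp only [Finset.mem_sigma, Finset.mem_sdiff] at hp
    simp [Finset.erase_insert hp.2.2]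
  · rintro ⟨M, x⟩ _
    rfl

theorem sum_powersetCard_succ_of_mem {O : Finset α} {v : α} (hv : v ∈ O) (t : ℕ)
    (F : Finset α → ℝ≥0∞) :
    ∑ M ∈ O.powersetCard (t + 1), F M = ∑ M ∈ (O.erase v).powersetCard (t + 1), F M
      + ∑ M ∈ (O.erase v).powersetCard t, F (insert v M) := by
  have hn : ∀ {j M}, M ∈ (O.erase v).powersetCard j → v ∉ M := fun hM h =>
    Finset.notMem_erase v O ((Finset.mem_powersetCard.1 hM).1 h)
  conv_lhs => rw [← Finset.insert_erase hv]
  rw [Finset.powersetCard_succ_insert (Finset.notMem_erase _ _), Finset.sum_union,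
    Finset.sum_image]
  · intro M hM M' hM' h
    rw [← Finset.erase_insert (hn hM), ← Finset.erase_insert (hn hM')]
    exact congrArg (fun s => s.erase v) h
  · rw [Finset.disjoint_left]
    intro M hM hM'
    obtain ⟨M', -, rfl⟩ := Finset.mem_image.1 hM'
    exact hn hM (Finset.mem_insert_self _ _)

/-- Averaging a fault over the uniformly random set `M` of nodes that may lose their server. -/
theorem sum_powersetCard_fault_le (O : Finset α) (t : ℕ) (f : Finset α → ℝ≥0∞) (B : ℝ≥0∞)
    (h : ∑ M ∈ O.powersetCard t, f M ≤ (O.card.choose t : ℝ≥0∞) * B) :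
    ∑ M ∈ O.powersetCard (t + 1), (M.card : ℝ≥0∞)⁻¹ * ∑ x ∈ M, (1 + f (M.erase x))
      ≤ (O.card.choose (t + 1) : ℝ≥0∞) * (1 + B) := by
  have h0 : ((t + 1 : ℕ) : ℝ≥0∞) ≠ 0 := by simp
  have h1 : ((t + 1 : ℕ) : ℝ≥0∞) ≠ ⊤ := ENNReal.natCast_ne_top _
  have h2 : ∀ M ∈ O.powersetCard (t + 1),
      (M.card : ℝ≥0∞)⁻¹ * ∑ x ∈ M, (1 + f (M.erase x))
        = 1 + ((t + 1 : ℕ) : ℝ≥0∞)⁻¹ * ∑ x ∈ M, f (M.erase x) := by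
    intro M hM
    rw [(Finset.mem_powersetCard.1 hM).2, Finset.sum_add_distrib, mul_add, Finset.sum_const,
      (Finset.mem_powersetCard.1 hM).2, nsmul_eq_mul, mul_one, ENNReal.inv_mul_cancel h0 h1]
  rw [Finset.sum_congr rfl h2, Finset.sum_add_distrib, Finset.sum_const, Finset.card_powersetCard,
    nsmul_eq_mul, mul_one, ← Finset.mul_sum, sum_powersetCard_sum_erase, mul_add, mul_one]
  refine add_le_add le_rfl ?_
  have h3 : (O.card.choose (t + 1) : ℝ≥0∞) * ((t + 1 : ℕ) : ℝ≥0∞)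
      = (O.card.choose t : ℝ≥0∞) * ((O.card - t : ℕ) : ℝ≥0∞) := by
    exact_mod_cast Nat.choose_succ_right_eq O.card t
  calc _ ≤ ((t + 1 : ℕ) : ℝ≥0∞)⁻¹
        * (((O.card - t : ℕ) : ℝ≥0∞) * ((O.card.choose t : ℝ≥0∞) * B)) := by gcongr
    _ = ((t + 1 : ℕ) : ℝ≥0∞)⁻¹ * ((O.card.choose (t + 1) : ℝ≥0∞) * ((t + 1 : ℕ) : ℝ≥0∞)) * B := by
        rw [h3]; ring
    _ = (((t + 1 : ℕ) : ℝ≥0∞)⁻¹ * ((t + 1 : ℕ) : ℝ≥0∞)) * (O.card.choose (t + 1) : ℝ≥0∞) * B := by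
        ring
    _ = _ := by rw [ENNReal.inv_mul_cancel h0 h1, one_mul]

end PowersetCard

/-! ### Expected cost of MARK within one phase. -/

section Mark

theorem MarkState.eq_of {V : Type u} {s s' : MarkState V} (hc : s.cached = s'.cached)
    (hm : s.marked = s'.marked) : s = s' := by
  cases s
  cases s'
  simp_all

variable {V : Type u} [DecidableEq V]

/-- The state of MARK within a phase: the nodes `U` already requested in the phase are served by
unmarked servers, the nodes in `M` by marked ones. -/
def phaseState (U M : Finset V) : MarkState V := ⟨U ∪ M, M, Finset.subset_union_right⟩

theorem mark_costFrom_hit {k : ℕ} {s : MarkState V} {v : V} (hv : v ∈ s.cached) (l : List V) :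
    (mark V).costFrom k s (v :: l) = (mark V).costFrom k (s.hit v) l := by
  change ∑' s', s.next k v s' * ((evictions s.cached s'.cached : ℝ≥0∞) +
    (mark V).costFrom k s' l) = _
  rw [MarkState.next, if_pos hv, tsum_pure_mul]
  simp [MarkState.hit, evictions]

theorem mark_costFrom_place {k : ℕ} {s : MarkState V} {v : V} (hv : v ∉ s.cached)
    (hk : s.cached.card < k) (l : List V) :
    (mark V).costFrom k s (v :: l) = (mark V).costFrom k (s.place v) l := by
  change ∑' s', s.next k v s' * ((evictions s.cached s'.cached : ℝ≥0∞) +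
    (mark V).costFrom k s' l) = _
  rw [MarkState.next, if_neg hv, if_pos hk, tsum_pure_mul]
  simp [MarkState.place, evictions, Finset.sdiff_eq_empty_iff_subset.2 (Finset.subset_insert _ _)]

theorem mark_costFrom_move {k : ℕ} {s : MarkState V} {v : V} (hv : v ∉ s.cached)
    (hk : ¬ s.cached.card < k) (hs : s.candidates.Nonempty) (l : List V) :
    (mark V).costFrom k s (v :: l) = (s.candidates.card : ℝ≥0∞)⁻¹ *
      ∑ w ∈ s.candidates, (1 + (mark V).costFrom k (s.move v w) l) := by
  change ∑' s', s.next k v s' * ((evictions s.cached s'.cached : ℝ≥0∞) +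
    (mark V).costFrom k s' l) = _
  rw [MarkState.next, if_neg hv, if_neg hk, dif_pos hs, tsum_map_mul, tsum_uniformOfFinset_mul]
  congr 1
  refine Finset.sum_congr rfl fun w hw => ?_
  have hw' := s.candidates_subset hw
  have h : s.cached \ (s.move v w).cached = {w} := by
    ext x
    simp only [MarkState.move, Finset.mem_sdiff, Finset.mem_insert, Finset.mem_erase,
      Finset.mem_singleton]
    constructor
    · rintro ⟨h1, h2⟩
      by_contra h3
      exact h2 (Or.inr ⟨h3, h1⟩)
    · rintro rfl
      exact ⟨hw', fun h => h.elim (fun h => hv (h ▸ hw')) fun h => h.1 rfl⟩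
  simp [evictions, h]

theorem mark_costFrom_phaseState_hit {k : ℕ} {U M : Finset V} {v : V} (hv : v ∈ U ∪ M)
    (l : List V) :
    (mark V).costFrom k (phaseState U M) (v :: l)
      = (mark V).costFrom k (phaseState (insert v U) (M.erase v)) l := by
  rw [mark_costFrom_hit (by exact hv)]
  congr 1
  refine MarkState.eq_of ?_ rfl
  ext x
  simp only [MarkState.hit, phaseState, Finset.mem_union, Finset.mem_insert,
    Finset.mem_erase] at hv ⊢
  by_cases hx : x = v
  · subst hx; simp [hv]
  · simp [hx]

theorem mark_costFrom_phaseState_move {k : ℕ} {U M : Finset V} {v : V} (hv : v ∉ U ∪ M)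
    (hU : Disjoint U M) (hk : U.card + M.card = k) (hM : M.Nonempty) (l : List V) :
    (mark V).costFrom k (phaseState U M) (v :: l) = (M.card : ℝ≥0∞)⁻¹ *
      ∑ w ∈ M, (1 + (mark V).costFrom k (phaseState (insert v U) (M.erase w)) l) := by
  have hc : (phaseState U M).candidates = M := if_neg hM.ne_empty
  rw [mark_costFrom_move (by exact hv) (by
    change ¬ (U ∪ M).card < k
    rw [Finset.card_union_of_disjoint hU]
    omega) (by rwa [hc]), hc]
  congr 1
  refine Finset.sum_congr rfl fun w hw => ?_
  congr 2
  refine MarkState.eq_of ?_ (congrArg (fun s => s.erase w) hc)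
  ext x
  have := Finset.disjoint_right.1 hU hw
  simp only [MarkState.move, phaseState, Finset.mem_union, Finset.mem_insert, Finset.mem_erase]
  by_cases hx : x = w
  · subst hx; simp [this]
  · simp [hx, or_assoc]

/-- At a fault that starts a new phase it does not matter whether all servers or none are
marked. -/
theorem mark_costFrom_new_phase {k : ℕ} {P : Finset V} {v : V} (hv : v ∉ P) (hP : P.card = k)
    (hk : 0 < k) (l : List V) :
    (mark V).costFrom k (phaseState P ∅) (v :: l)
      = (mark V).costFrom k (phaseState ∅ P) (v :: l) := by
  have hne : P.Nonempty := Finset.card_pos.1 (by omega)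
  have h1 : (phaseState P ∅).cached = P := Finset.union_empty P
  have h2 : (phaseState ∅ P).cached = P := Finset.empty_union P
  have h3 : (phaseState P ∅).candidates = P := (if_pos rfl).trans h1
  have h4 : (phaseState ∅ P).candidates = P := if_neg hne.ne_empty
  rw [mark_costFrom_move (by rwa [h1]) (by rw [h1]; omega) (by rwa [h3]),
    mark_costFrom_move (by rwa [h2]) (by rw [h2]; omega) (by rwa [h4]), h3, h4]
  congr 1
  refine Finset.sum_congr rfl fun w _ => ?_
  congr 2
  exact MarkState.eq_of (by simp [MarkState.move, h1, h2]) (by simp [MarkState.move, h3, h4])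

/-- MARK on the requests `w` of (a final part of) a phase, averaged over the uniformly random set
`M` of marked nodes; `O` holds the nodes of the previous phase not yet requested in this one. -/
theorem sum_mark_costFrom_phase_le (k m : ℕ) (rest : List V) (K : ℝ≥0∞) (w : List V)
    (U O : Finset V) (t : ℕ) (hUO : Disjoint U O) (ht : U.card + t = k) (hto : t ≤ O.card)
    (hw : (U ∪ w.toFinset).card ≤ k)
    (hm : O.card - t + (w.toFinset \ (U ∪ O)).card ≤ m)
    (hK : ∀ M ⊆ O \ w.toFinset, (U ∪ w.toFinset).card + M.card = k →
      (mark V).costFrom k (phaseState (U ∪ w.toFinset) M) rest ≤ K) :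
    ∑ M ∈ O.powersetCard t, (mark V).costFrom k (phaseState U M) (w ++ rest)
      ≤ (O.card.choose t : ℝ≥0∞) * ((w.toFinset \ (U ∪ O)).card
        + m * ∑ i ∈ Finset.Ioc (O.card - (w.toFinset ∩ O).card) O.card, (i : ℝ≥0∞)⁻¹ + K) := by
  induction w generalizing U O t with
  | nil =>
    simp only [List.toFinset_nil, Finset.union_empty, Finset.sdiff_empty] at hK
    have : ∀ M ∈ O.powersetCard t, (mark V).costFrom k (phaseState U M) ([] ++ rest) ≤ K := by
      intro M hM
      rw [Finset.mem_powersetCard] at hM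
      exact hK M hM.1 (by omega)
    refine (Finset.sum_le_card_nsmul _ _ _ this).trans ?_
    rw [Finset.card_powersetCard, nsmul_eq_mul]
    gcongr
    exact le_add_self
  | cons v w ih =>
    have hU' : U ∪ (v :: w).toFinset = insert v U ∪ w.toFinset := by
      ext x; simp
    have hO' : O \ (v :: w).toFinset = O.erase v \ w.toFinset := by
      ext x; simp; tauto
    rw [hU'] at hw
    rw [hU', hO'] at hK
    rw [List.cons_append]
    have hdis : ∀ {j M}, M ∈ O.powersetCard j → Disjoint U M := fun hM =>
      hUO.mono_right (Finset.mem_powersetCard.1 hM).1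
    by_cases hvU : v ∈ U
    · have hvO := Finset.disjoint_left.1 hUO hvU
      rw [Finset.insert_eq_of_mem hvU] at hw
      rw [Finset.insert_eq_of_mem hvU, Finset.erase_eq_of_notMem hvO] at hK
      have h1 : (v :: w).toFinset \ (U ∪ O) = w.toFinset \ (U ∪ O) := by
        ext x; simp only [List.toFinset_cons, Finset.mem_sdiff, Finset.mem_insert,
          Finset.mem_union]
        by_cases hx : x = v
        · subst hx; simp [hvU]
        · simp [hx]
      have h2 : (v :: w).toFinset ∩ O = w.toFinset ∩ O := by
        rw [List.toFinset_cons, Finset.insert_inter_of_notMem hvO]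
      rw [h1] at hm ⊢
      rw [h2]
      refine le_trans (le_of_eq ?_) (ih U O t hUO ht hto hw hm hK)
      refine Finset.sum_congr rfl fun M hM => ?_
      rw [mark_costFrom_phaseState_hit (Finset.mem_union_left _ hvU),
        Finset.insert_eq_of_mem hvU,
        Finset.erase_eq_of_notMem (Finset.disjoint_left.1 (hdis hM) hvU)]
    · have hcU : (insert v U).card = U.card + 1 := Finset.card_insert_of_notMem hvU
      have hlt : U.card + 1 ≤ k := by
        rw [← hcU]
        exact (Finset.card_le_card Finset.subset_union_left).trans hw
      -- A node new to the phase can be requested only while fewer than `k` nodes of it have been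
      -- seen, so some marked server remains.
      obtain ⟨t, rfl⟩ : ∃ j, t = j + 1 := ⟨t - 1, by omega⟩
      have hmove : ∀ M ∈ O.powersetCard (t + 1), v ∉ M →
          (mark V).costFrom k (phaseState U M) (v :: (w ++ rest)) = (M.card : ℝ≥0∞)⁻¹ *
            ∑ x ∈ M, (1 +
              (mark V).costFrom k (phaseState (insert v U) (M.erase x)) (w ++ rest)) := by
        intro M hM hv
        have hM' := (Finset.mem_powersetCard.1 hM).2
        exact mark_costFrom_phaseState_move (by simp [hvU, hv]) (hdis hM) (by omega)
          (Finset.card_pos.1 (by omega)) _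
      by_cases hvO : v ∈ O
      · have hcO : (O.erase v).card + 1 = O.card := Finset.card_erase_add_one hvO
        have h1 : (v :: w).toFinset \ (U ∪ O) = w.toFinset \ (insert v U ∪ O.erase v) := by
          ext x; simp only [List.toFinset_cons, Finset.mem_sdiff, Finset.mem_insert,
            Finset.mem_union, Finset.mem_erase]
          by_cases hx : x = v
          · subst hx; simp [hvO]
          · simp [hx]
        have h2 : ((v :: w).toFinset ∩ O).card = (w.toFinset ∩ O.erase v).card + 1 := by
          have : (v :: w).toFinset ∩ O = insert v (w.toFinset ∩ O.erase v) := by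
            ext x; simp only [List.toFinset_cons, Finset.mem_inter, Finset.mem_insert,
              Finset.mem_erase]
            by_cases hx : x = v
            · subst hx; simp [hvO]
            · simp [hx]
          rw [this, Finset.card_insert_of_notMem (by simp)]
        rw [h1] at hm ⊢
        rw [h2]
        have h3 := ih (insert v U) (O.erase v) t
          (by
            rw [Finset.disjoint_insert_left]
            exact ⟨Finset.notMem_erase _ _, hUO.mono_right (Finset.erase_subset _ _)⟩)
          (by omega) (by omega) hw (by omega) hK
        have h4 := sum_powersetCard_fault_le _ _ _ _ h3
        -- For an old node `v`, split by whether it still has its server: if `v ∈ M` the request is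
        -- a hit, otherwise a fault. Either way the remaining marked set is uniform among
        -- `t`-subsets of `O.erase v`.
        rw [sum_powersetCard_succ_of_mem hvO]
        have h5 : ∀ M ∈ (O.erase v).powersetCard (t + 1), _ := fun M hM =>
          hmove M (Finset.powersetCard_mono (Finset.erase_subset _ _) hM) fun h =>
            Finset.notMem_erase v O ((Finset.mem_powersetCard.1 hM).1 h)
        have h6 : ∀ M ∈ (O.erase v).powersetCard t,
            (mark V).costFrom k (phaseState U (insert v M)) (v :: (w ++ rest))
              = (mark V).costFrom k (phaseState (insert v U) M) (w ++ rest) := by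
          intro M hM
          have hM' := (Finset.mem_powersetCard.1 hM).1
          rw [mark_costFrom_phaseState_hit (by simp), Finset.erase_insert]
          exact fun h => Finset.notMem_erase v O (hM' h)
        rw [Finset.sum_congr rfl h5, Finset.sum_congr rfl h6]
        refine (add_le_add h4 h3).trans ?_
        have hq : (w.toFinset ∩ O.erase v).card ≤ (O.erase v).card :=
          Finset.card_le_card Finset.inter_subset_right
        have h7 : O.card - ((w.toFinset ∩ O.erase v).card + 1)
            = (O.erase v).card - (w.toFinset ∩ O.erase v).card := by omega
        rw [h7, ← hcO, Finset.sum_Ioc_succ_top (by omega)]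
        -- The proportion of `M` missing `v` is `(O.card - (t + 1)) / O.card`, and the numerator
        -- counts the new nodes seen so far, hence is at most `m`. This is the fault probability,
        -- the harmonic term for `i = O.card`.
        have h8 : (((O.erase v).card).choose (t + 1) : ℝ≥0∞)
            ≤ (((O.erase v).card + 1).choose (t + 1) : ℝ≥0∞)
              * (m * (((O.erase v).card + 1 : ℕ) : ℝ≥0∞)⁻¹) := by
          rw [← mul_assoc, ← div_eq_mul_inv, ENNReal.le_div_iff_mul_le (by simp) (by simp)]
          have h9 := Nat.choose_mul_succ_eq (O.erase v).card (t + 1)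
          have h10 : (O.erase v).card + 1 - (t + 1) ≤ m := by omega
          exact_mod_cast h9.trans_le (Nat.mul_le_mul_left _ h10)
        have h9 : (((O.erase v).card + 1).choose (t + 1) : ℝ≥0∞)
            = ((O.erase v).card.choose t : ℝ≥0∞) + ((O.erase v).card.choose (t + 1) : ℝ≥0∞) := by
          exact_mod_cast Nat.choose_succ_succ _ _
        generalize ∑ i ∈ Finset.Ioc ((O.erase v).card - (w.toFinset ∩ O.erase v).card)
          (O.erase v).card, (i : ℝ≥0∞)⁻¹ = H at *
        generalize ((w.toFinset \ (insert v U ∪ O.erase v)).card : ℝ≥0∞) = N at *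
        calc _ = ((O.erase v).card.choose (t + 1) : ℝ≥0∞)
              + (((O.erase v).card.choose t : ℝ≥0∞) + ((O.erase v).card.choose (t + 1) : ℝ≥0∞))
                * (N + m * H + K) := by ring
          _ ≤ (((O.erase v).card + 1).choose (t + 1) : ℝ≥0∞)
                * (m * (((O.erase v).card + 1 : ℕ) : ℝ≥0∞)⁻¹)
              + (((O.erase v).card + 1).choose (t + 1) : ℝ≥0∞) * (N + m * H + K) := by
            rw [h9] at h8 ⊢
            gcongr
          _ = _ := by ring
      -- A node outside `U ∪ O` is a certain fault, contributing 1 to the count of new nodes.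
      · have h1 : ((v :: w).toFinset \ (U ∪ O)).card
            = (w.toFinset \ (insert v U ∪ O)).card + 1 := by
          have : (v :: w).toFinset \ (U ∪ O) = insert v (w.toFinset \ (insert v U ∪ O)) := by
            ext x; simp only [List.toFinset_cons, Finset.mem_sdiff, Finset.mem_insert,
              Finset.mem_union]
            by_cases hx : x = v
            · subst hx; simp [hvO, hvU]
            · simp [hx]
          rw [this, Finset.card_insert_of_notMem (by simp)]
        have h2 : (v :: w).toFinset ∩ O = w.toFinset ∩ O := by
          rw [List.toFinset_cons, Finset.insert_inter_of_notMem hvO]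
        rw [Finset.erase_eq_of_notMem hvO] at hK
        rw [h1] at hm ⊢
        rw [h2]
        have h3 := ih (insert v U) O t
          (by
            rw [Finset.disjoint_insert_left]
            exact ⟨hvO, hUO⟩)
          (by omega) (by omega) hw (by omega) hK
        have h4 := sum_powersetCard_fault_le _ _ _ _ h3
        rw [Finset.sum_congr rfl fun M hM => hmove M hM fun h =>
          hvO ((Finset.mem_powersetCard.1 hM).1 h)]
        refine h4.trans (le_of_eq ?_)
        push_cast
        ring

/-- In the first phase MARK only places servers. -/
theorem mark_costFrom_first_phase {k : ℕ} (w rest : List V) (U : Finset V)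
    (hw : (U ∪ w.toFinset).card ≤ k) :
    (mark V).costFrom k (phaseState U ∅) (w ++ rest)
      = (mark V).costFrom k (phaseState (U ∪ w.toFinset) ∅) rest := by
  induction w generalizing U with
  | nil => simp
  | cons v w ih =>
    have hU' : U ∪ (v :: w).toFinset = insert v U ∪ w.toFinset := by
      ext x; simp
    rw [hU'] at hw ⊢
    rw [List.cons_append, ← ih _ hw]
    by_cases hv : v ∈ U
    · rw [mark_costFrom_phaseState_hit (by simpa using hv)]
      simp
    · have h1 := (Finset.card_le_card Finset.subset_union_left).trans hw
      rw [Finset.card_insert_of_notMem hv] at h1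
      rw [mark_costFrom_place (by simpa [phaseState] using hv) (by
        simp only [phaseState, Finset.union_empty]
        omega)]
      congr 1
      exact MarkState.eq_of (by simp [MarkState.place, phaseState]) rfl

/-! ### From harmonic sums to MARK's competitive bound. -/

theorem sum_Ioc_inv_le_log {a n : ℕ} (ha : 0 < a) (han : a ≤ n) :
    ∑ i ∈ Finset.Ioc a n, (i : ℝ)⁻¹ ≤ Real.log n - Real.log a := by
  induction n, han using Nat.le_induction with
  | base => simp
  | succ n han ih =>
    rw [Finset.sum_Ioc_succ_top han]
    have hn : (0 : ℝ) < n := by exact_mod_cast (show 0 < n by omega)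
    have h1 := Real.one_sub_inv_le_log_of_pos (x := ((n : ℝ) + 1) / n) (by positivity)
    rw [Real.log_div (by positivity) hn.ne'] at h1
    have h2 : 1 - (((n : ℝ) + 1) / n)⁻¹ = ((n : ℝ) + 1)⁻¹ := by
      field_simp
      ring
    push_cast
    linarith

/-- This is `log y ≤ y - 1` at `y = k * exp (-ρ) / m`, multiplied by `m`. It replaces the concave
cost of a phase by a bound linear in `m`, which can be compared with the optimum's `g + m` moves for
`g = k - h`. -/
theorem mul_one_add_log_le {k m g ρ : ℝ} (hk : 0 < k) (hm : 0 < m)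
    (hρ : k ≤ ρ * Real.exp ρ * g) :
    m * (1 + (Real.log k - Real.log m)) ≤ ρ * (g + m) := by
  have hy : 0 < k * Real.exp (-ρ) / m := by positivity
  have h1 := Real.log_le_sub_one_of_pos hy
  rw [Real.log_div (by positivity) hm.ne', Real.log_mul hk.ne' (Real.exp_pos _).ne',
    Real.log_exp] at h1
  have h2 := mul_le_mul_of_nonneg_left h1 hm.le
  have h3 : m * (k * Real.exp (-ρ) / m - 1) = k * Real.exp (-ρ) - m := by
    field_simp
  have h4 : k * Real.exp (-ρ) ≤ ρ * g := by
    calc _ ≤ ρ * Real.exp ρ * g * Real.exp (-ρ) := by gcongr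
      _ = ρ * g * (Real.exp ρ * Real.exp (-ρ)) := by ring
      _ = ρ * g := by rw [← Real.exp_add]; simp
  nlinarith

/-- A phase with `m` new nodes costs MARK at most `m * (1 + log (k / m)) ≤ ρ * (g + m)` in
expectation. -/
theorem mark_costFrom_phase_le {k : ℕ} (hk : 0 < k) {g ρ : ℝ}
    (hρ : (k : ℝ) ≤ ρ * Real.exp ρ * g) (v : V) (w rest : List V) (P : Finset V)
    (hP : P.card = k) (hv : v ∉ P) (K : ℝ≥0∞) (hw : (v :: w).toFinset.card ≤ k)
    (hK : ∀ M, (v :: w).toFinset.card + M.card = k →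
      (mark V).costFrom k (phaseState (v :: w).toFinset M) rest ≤ K) :
    (mark V).costFrom k (phaseState P ∅) (v :: w ++ rest)
      ≤ ENNReal.ofReal (ρ * (g + ((v :: w).toFinset \ P).card)) + K := by
  set m := ((v :: w).toFinset \ P).card with hm
  rw [List.cons_append, mark_costFrom_new_phase hv hP hk, ← List.cons_append]
  -- At the start of the phase `U` is empty and all of `P` is marked, so the average runs over the
  -- single `k`-subset of `P`.
  have h1 := sum_mark_costFrom_phase_le k m rest K (v :: w) ∅ P k (by simp) (by simp) hP.ge
    (by rw [Finset.empty_union]; exact hw) (by simp [hP, hm])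
    (fun M _ hM => by rw [Finset.empty_union] at hM ⊢; exact hK M hM)
  rw [← hP, Finset.powersetCard_self, Finset.sum_singleton, Nat.choose_self, Nat.cast_one,
    one_mul, Finset.empty_union, ← hm, hP] at h1
  refine h1.trans (add_le_add_left ?_ K)
  have hmpos : 0 < m := Finset.card_pos.2 ⟨v, by simp [hv]⟩
  have hq : m + ((v :: w).toFinset ∩ P).card ≤ k := by
    rw [hm, Finset.card_sdiff_add_card_inter]
    exact hw
  generalize ((v :: w).toFinset ∩ P).card = q at *
  have h2 : ∑ i ∈ Finset.Ioc (k - q) k, (i : ℝ≥0∞)⁻¹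
      = ENNReal.ofReal (∑ i ∈ Finset.Ioc (k - q) k, (i : ℝ)⁻¹) := by
    rw [ENNReal.ofReal_sum_of_nonneg fun i _ => by positivity]
    refine Finset.sum_congr rfl fun i hi => ?_
    have hi : 0 < i := by
      have := (Finset.mem_Ioc.1 hi).1
      omega
    rw [ENNReal.ofReal_inv_of_pos (by exact_mod_cast hi), ENNReal.ofReal_natCast]
  rw [h2, ← ENNReal.ofReal_natCast, ← ENNReal.ofReal_mul (by positivity), ← ENNReal.ofReal_add
    (by positivity) (by positivity)]
  refine ENNReal.ofReal_le_ofReal (le_trans ?_ (mul_one_add_log_le (m := m)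
    (by exact_mod_cast hk) (by exact_mod_cast hmpos) hρ))
  rw [mul_add, mul_one]
  have h3 := sum_Ioc_inv_le_log (a := k - q) (n := k) (by omega) (by omega)
  -- The phase has at most `k` distinct nodes, `m` new and `q` old, so the harmonic sum stops no
  -- lower than `m`.
  have h4 : Real.log m ≤ Real.log (k - q : ℕ) :=
    Real.log_le_log (by exact_mod_cast hmpos) (by exact_mod_cast (show m ≤ k - q by omega))
  gcongr
  linarith

/-- Each phase is charged to the optimum's moves during it and the phase before it. Hence moves
after `b` are counted at most twice, and moves in `[a, b)` once. -/
theorem mark_costFrom_le_of_profile {k h : ℕ} (hh : 0 < h) (hhk : h ≤ k) {ρ : ℝ} (hρ0 : 0 < ρ)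
    (hρ : (k : ℝ) ≤ ρ * Real.exp ρ * ((k : ℝ) - h)) {r : List V} {E : ℕ → ℕ}
    (hmono : Monotone E)
    (hE : ∀ a e, a < e → e ≤ r.length → (reqs r a e).card + E (a + 1) ≤ h + E e)
    (a b : ℕ) (hab : a ≤ b) (hb : b < r.length) (hcard : (reqs r a b).card = k)
    (hnot : r[b] ∉ reqs r a b) :
    (mark V).costFrom k (phaseState (reqs r a b) ∅) (r.drop b)
      ≤ ENNReal.ofReal (ρ * ((E b : ℝ) - E a + 2 * ((E r.length : ℝ) - E b))) := by
  have hk : 0 < k := by omega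
  have hg : (0 : ℝ) ≤ (k : ℝ) - h := sub_nonneg.2 (by exact_mod_cast hhk)
  have key : ∀ a b, a ≤ b → ∀ hb : b < r.length, (reqs r a b).card = k → r[b] ∉ reqs r a b →
      ∀ e, b < e → e ≤ r.length → (reqs r b e).card ≤ k → ∀ K : ℝ≥0∞,
      (∀ M, (reqs r b e).card + M.card = k →
        (mark V).costFrom k (phaseState (reqs r b e) M) (r.drop e) ≤ K) →
      (mark V).costFrom k (phaseState (reqs r a b) ∅) (r.drop b)
        ≤ ENNReal.ofReal (ρ * ((E e : ℝ) - E a)) + K := by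
    intro a b hab hb hcard hnot e hbe he hce K hK
    have hlist : (r.take e).drop b = r[b] :: (r.take e).drop (b + 1) := by
      rw [List.drop_eq_getElem_cons (by rw [List.length_take]; omega)]
      simp
    have hdrop : r.drop b = r[b] :: (r.take e).drop (b + 1) ++ r.drop e := by
      rw [← hlist]
      conv_lhs => rw [← List.take_append_drop e r]
      rw [List.drop_append_of_le_length (by rw [List.length_take]; omega)]
    unfold reqs at hce hK
    rw [hlist] at hce hK
    rw [hdrop]
    refine (mark_costFrom_phase_le hk hρ _ _ _ _ hcard hnot K hce hK).trans ?_
    refine add_le_add_left (ENNReal.ofReal_le_ofReal (mul_le_mul_of_nonneg_left ?_ hρ0.le)) K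
    rw [← hlist]
    change (k : ℝ) - h + ((reqs r b e \ reqs r a b).card : ℝ) ≤ _
    have h1 := hE a e (by omega) he
    rw [reqs_union r hab hbe.le, Finset.union_comm, ← Finset.card_sdiff_add_card, hcard] at h1
    have h2 := hmono (Nat.le_succ a)
    have h3 : (k : ℝ) + (reqs r b e \ reqs r a b).card + E a ≤ h + E e := by
      exact_mod_cast (show k + (reqs r b e \ reqs r a b).card + E a ≤ h + E e by
        rw [Nat.succ_eq_add_one] at h2
        omega)
    linarith
  have hEb : ∀ i j, i ≤ j → (E i : ℝ) ≤ E j := fun i j hij => by exact_mod_cast hmono hij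
  induction _hn : r.length - b using Nat.strong_induction_on generalizing a b with
  | _ n ih =>
    by_cases hc : (reqs r b r.length).card ≤ k
    · refine (key a b hab hb hcard hnot r.length hb le_rfl hc 0 fun M _ => ?_).trans ?_
      · simp [PagingStrategy.costFrom]
      · rw [add_zero]
        refine ENNReal.ofReal_le_ofReal (mul_le_mul_of_nonneg_left ?_ hρ0.le)
        linarith [hEb b r.length hb.le]
    · obtain ⟨e, he, hbe, hce, hne⟩ := exists_phase_end r k b hb.le (by omega)
      have hlt : b < e := by
        rcases hbe.lt_or_eq with h | h
        · exact h
        · subst h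
          simp [reqs_self] at hce
          omega
      refine (key a b hab hb hcard hnot e hlt he.le hce.le
        (ENNReal.ofReal (ρ * ((E e : ℝ) - E b + 2 * ((E r.length : ℝ) - E e))))
        fun M hM => ?_).trans ?_
      -- A complete phase has `k` distinct nodes, so no marked server is left and the next phase
      -- starts from a deterministic state.
      · obtain rfl : M = ∅ := Finset.card_eq_zero.1 (by omega)
        exact ih (r.length - e) (by omega) b e hbe he hce hne rfl
      · rw [← ENNReal.ofReal_add]
        · refine ENNReal.ofReal_le_ofReal ?_
          rw [← mul_add]
          refine mul_le_mul_of_nonneg_left ?_ hρ0.le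
          linarith
        · exact mul_nonneg hρ0.le (sub_nonneg.2 (hEb _ _ (by omega)))
        · refine mul_nonneg hρ0.le ?_
          linarith [hEb b e hbe, hEb e r.length he.le]

theorem mark_cost_le {k h : ℕ} (hh : 0 < h) (hhk : h ≤ k) {ρ : ℝ} (hρ0 : 0 < ρ)
    (hρ : (k : ℝ) ≤ ρ * Real.exp ρ * ((k : ℝ) - h)) (r : List V) :
    (mark V).cost k r ≤ ENNReal.ofReal (2 * ρ * opt h r) := by
  have hinit : (mark V).init k = phaseState ∅ ∅ := rfl
  rw [PagingStrategy.cost, hinit]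
  by_cases hc : (reqs r 0 r.length).card ≤ k
  · have := mark_costFrom_first_phase (k := k) r [] ∅ (by simpa [reqs] using hc)
    rw [List.append_nil] at this
    rw [this]
    simp [PagingStrategy.costFrom]
  · obtain ⟨E, hmono, hlen, hE⟩ := exists_opt_profile hh r
    obtain ⟨b, hb, -, hcard, hnot⟩ := exists_phase_end r k 0 (Nat.zero_le _) (by omega)
    have h1 := mark_costFrom_le_of_profile hh hhk hρ0 hρ hmono hE 0 b (Nat.zero_le _) hb hcard hnot
    have h2 := mark_costFrom_first_phase (k := k) (r.take b) (r.drop b) ∅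
      (by rw [Finset.empty_union]; exact hcard.le)
    rw [List.take_append_drop, Finset.empty_union] at h2
    rw [h2]
    refine h1.trans (ENNReal.ofReal_le_ofReal ?_)
    rw [← hlen, mul_comm 2 ρ, mul_assoc]
    refine mul_le_mul_of_nonneg_left ?_ hρ0.le
    have h3 : (0 : ℝ) ≤ E 0 := by positivity
    have h4 : (0 : ℝ) ≤ E b := by positivity
    linarith

end Mark

/-! ### Geometric decay bounds the number of bad values. -/

section Counting

/-- At most `s` elements of `S` lie in `(x - s, x]`; take for `y` the largest of the remaining ones
below `x`. -/
theorem exists_add_le_of_card {S : Finset ℕ} {s j x : ℕ}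
    (hlt : (j + 1) * s < (S.filter (· ≤ x)).card) :
    ∃ y ∈ S, y + s ≤ x ∧ j * s < (S.filter (· ≤ y)).card := by
  have hsub : S.filter (· ≤ x) ⊆ S.filter (· + s ≤ x) ∪ Finset.Ico (x + 1 - s) (x + 1) := by
    intro y hy
    simp only [Finset.mem_filter, Finset.mem_union, Finset.mem_Ico] at hy ⊢
    by_cases h : y + s ≤ x
    · exact Or.inl ⟨hy.1, h⟩
    · exact Or.inr (by omega)
  have h2 := (Finset.card_le_card hsub).trans (Finset.card_union_le _ _)
  rw [Nat.card_Ico] at h2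
  have h3 : j * s < (S.filter (· + s ≤ x)).card := by
    rw [add_mul] at hlt
    omega
  have hne : (S.filter (· + s ≤ x)).Nonempty := Finset.card_pos.1 (by omega)
  have hy := Finset.mem_filter.1 (Finset.max'_mem _ hne)
  refine ⟨_, hy.1, hy.2, h3.trans_le (Finset.card_le_card fun z hz => ?_)⟩
  exact Finset.mem_filter.2 ⟨(Finset.mem_filter.1 hz).1, Finset.le_max' _ _ hz⟩

/-- If `F` drops by the factor `θ` between elements of `S` at distance `s`, it decays
geometrically in the number of elements of `S` passed. -/
theorem le_pow_mul_of_drop {F : ℕ → ℝ} {S : Finset ℕ} {s : ℕ} {θ : ℝ} (hθ : 0 ≤ θ)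
    (h1 : ∀ x ∈ S, F x ≤ F 1) (hdrop : ∀ x ∈ S, ∀ y ∈ S, y + s ≤ x → F x ≤ θ * F y) (j : ℕ) :
    ∀ x ∈ S, j * s < (S.filter (· ≤ x)).card → F x ≤ θ ^ j * F 1 := by
  induction j with
  | zero => simpa using fun x hx _ => h1 x hx
  | succ j ih =>
    intro x hx hlt
    obtain ⟨y, hy, hyx, hlt'⟩ := exists_add_le_of_card hlt
    calc F x ≤ θ * F y := hdrop x hx y hy hyx
      _ ≤ θ * (θ ^ j * F 1) := mul_le_mul_of_nonneg_left (ih y hy hlt') hθ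
      _ = θ ^ (j + 1) * F 1 := by ring

/-- If `S` were larger, some `y` at distance `s` below its maximum would come after `j` drops, so `P
* F y ≤ P * θ ^ j * F 1 ≤ Q * F 1`, against `hlast`. -/
theorem card_le_of_drop {F : ℕ → ℝ} {S : Finset ℕ} {s j : ℕ} {θ P Q : ℝ} (hθ : 0 ≤ θ)
    (hP : 0 ≤ P) (hF : 0 ≤ F 1) (h1 : ∀ x ∈ S, F x ≤ F 1)
    (hdrop : ∀ x ∈ S, ∀ y ∈ S, y + s ≤ x → F x ≤ θ * F y)
    (hlast : ∀ x ∈ S, ∀ y ∈ S, y + s ≤ x → Q * F 1 < P * F y) (hj : P * θ ^ j ≤ Q) :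
    S.card ≤ (j + 1) * s := by
  by_contra hc
  have hne : S.Nonempty := Finset.card_pos.1 (by omega)
  have hx := S.max'_mem hne
  have hS : S.filter (· ≤ S.max' hne) = S :=
    Finset.filter_true_of_mem fun y hy => S.le_max' y hy
  obtain ⟨y, hy, hyx, hlt⟩ := exists_add_le_of_card (S := S) (s := s) (j := j) (x := S.max' hne)
    (by rw [hS]; omega)
  have h2 := mul_le_mul_of_nonneg_left (le_pow_mul_of_drop hθ h1 hdrop j _ hy hlt) hP
  have h3 := hlast _ hx _ hy hyx
  have h5 := mul_le_mul_of_nonneg_right hj hF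
  linarith

end Counting

/-! ### Loose competitiveness from bounds against fewer servers. -/

section Loose

variable {V : Type u} [DecidableEq V]

-- Take `b = 1` and let `g n` be the supremum over `r` of the number of bad `k`; it is finite
-- because that number is at most `n`.
open Classical in
theorem looselyCompetitive_of_eventually_card_le {X : PagingStrategy.{u, v} V} {c : ℕ → ℝ}
    (h : ∀ d : ℝ, 0 < d → ∀ ε : ℝ, 0 < ε → ∀ᶠ n : ℕ in atTop, ∀ r : List V,
      (((Finset.Icc 1 n).filter fun k => X.cost k r ≥ ENNReal.ofReal
          (max (c k * (opt k r : ℝ)) ((opt 1 r : ℝ) / (n : ℝ) ^ d) + 1)).card : ℝ) ≤ ε * n) :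
    X.LooselyCompetitive c := by
  refine ⟨1, fun d hd => ⟨fun n => ⨆ r : List V,
    (((Finset.Icc 1 n).filter fun k => X.cost k r ≥ ENNReal.ofReal
      (max (c k * (opt k r : ℝ)) ((opt 1 r : ℝ) / (n : ℝ) ^ d) + 1)).card : ℝ), ?_, ?_⟩⟩
  · rw [isLittleO_iff]
    intro ε hε
    filter_upwards [h d hd ε hε] with n hn
    rw [Real.norm_of_nonneg (Real.iSup_nonneg fun r => by positivity),
      Real.norm_of_nonneg (by positivity)]
    exact ciSup_le hn
  · intro n r
    refine le_ciSup (f := fun r : List V =>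
      (((Finset.Icc 1 n).filter fun k => X.cost k r ≥ ENNReal.ofReal
        (max (c k * (opt k r : ℝ)) ((opt 1 r : ℝ) / (n : ℝ) ^ d) + 1)).card : ℝ))
      ⟨(n : ℝ), ?_⟩ r
    rintro _ ⟨r, rfl⟩
    have := Finset.card_filter_le (Finset.Icc 1 n) fun k => X.cost k r ≥ ENNReal.ofReal
      (max (c k * (opt k r : ℝ)) ((opt 1 r : ℝ) / (n : ℝ) ^ d) + 1)
    rw [Nat.card_Icc, Nat.add_sub_cancel] at this
    exact Nat.cast_le.2 this

/-- Loose competitiveness follows if, for `k` in a range `(a, n]`, the cost with `k` servers is at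
most `c k * exp (-δ)` times the optimum for `k - s` servers, where `s / δ` is small compared to
`n / log n`. -/
theorem looselyCompetitive_of_cost_le {X : PagingStrategy.{u, v} V} {c : ℕ → ℝ}
    (hpos : ∀ k, 1 ≤ k → 0 < c k) (hmono : MonotoneOn c (Set.Ici 1))
    (hc : ∀ᶠ n : ℕ in atTop, c n ≤ (n : ℝ) ^ 2)
    (h : ∀ d : ℝ, 0 < d → ∀ ε : ℝ, 0 < ε → ∀ᶠ n : ℕ in atTop, ∃ a s : ℕ, ∃ δ : ℝ, 0 < δ ∧
      (a : ℝ) + ((d + 2) * Real.log n / δ + 2) * s ≤ ε * n ∧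
      ∀ k h : ℕ, a < k → k ≤ n → 0 < h → h + s ≤ k → ∀ r : List V,
        X.cost k r ≤ ENNReal.ofReal (c k * Real.exp (-δ) * opt h r)) :
    X.LooselyCompetitive c := by
  classical
  refine looselyCompetitive_of_eventually_card_le fun d hd ε hε => ?_
  filter_upwards [h d hd ε hε, hc, eventually_ge_atTop 1] with n hn hcn hn1 r
  obtain ⟨a, s, δ, hδ, has, hcost⟩ := hn
  have hn0 : (0 : ℝ) < n := by exact_mod_cast hn1
  set S := (Finset.Icc 1 n).filter fun k => X.cost k r ≥ ENNReal.ofReal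
    (max (c k * (opt k r : ℝ)) ((opt 1 r : ℝ) / (n : ℝ) ^ d) + 1)
  set j := ⌈(d + 2) * Real.log n / δ⌉₊ with hj
  have hS : ∀ k ∈ S, 1 ≤ k ∧ k ≤ n := fun k hk => Finset.mem_Icc.1 (Finset.mem_filter.1 hk).1
  have hlog : 0 ≤ Real.log n := Real.log_natCast_nonneg n
  have hbad : ∀ x ∈ S.filter (a < ·), ∀ y ∈ S.filter (a < ·), y + s ≤ x →
      c x * opt x r < c x * Real.exp (-δ) * opt y r ∧
      (opt 1 r : ℝ) / (n : ℝ) ^ d < c x * Real.exp (-δ) * opt y r := by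
    intro x hx y hy hyx
    rw [Finset.mem_filter] at hx hy
    have h1 := hcost x y hx.2 (hS x hx.1).2 (hS y hy.1).1 hyx r
    have h2 := (Finset.mem_filter.1 hx.1).2.le.trans h1
    have h3 : 0 ≤ max (c x * (opt x r : ℝ)) ((opt 1 r : ℝ) / (n : ℝ) ^ d) :=
      le_max_of_le_right (by positivity)
    rw [ENNReal.ofReal_le_ofReal_iff'] at h2
    -- The additive 1 makes the left side positive, so the comparison passes from `ENNReal.ofReal`
    -- to the reals, and it makes both inequalities of `hbad` strict.
    have h4 := h2.resolve_right (by linarith)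
    have h5 := le_max_left (c x * (opt x r : ℝ)) ((opt 1 r : ℝ) / (n : ℝ) ^ d)
    have h6 := le_max_right (c x * (opt x r : ℝ)) ((opt 1 r : ℝ) / (n : ℝ) ^ d)
    exact ⟨by linarith, by linarith⟩
  have hmem : ∀ x ∈ S.filter (a < ·), 1 ≤ x ∧ x ≤ n := fun x hx =>
    hS x (Finset.mem_filter.1 hx).1
  have hcard : (S.filter (a < ·)).card ≤ (j + 1) * s := by
    refine card_le_of_drop (F := fun k => (opt k r : ℝ)) (θ := Real.exp (-δ)) (P := c n)
      (Q := ((n : ℝ) ^ d)⁻¹) (Real.exp_pos _).le (hpos n hn1).le (by positivity) ?_ ?_ ?_ ?_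
    · intro x hx
      exact_mod_cast opt_anti one_pos (hmem x hx).1 r
    · intro x hx y hy hyx
      have h1 := (hbad x hx y hy hyx).1
      rw [mul_assoc] at h1
      exact (lt_of_mul_lt_mul_left h1 (hpos x (hmem x hx).1).le).le
    · intro x hx y hy hyx
      have h1 := (hbad x hx y hy hyx).2
      rw [div_eq_inv_mul] at h1
      refine h1.trans_le (mul_le_mul_of_nonneg_right ?_ (by positivity))
      have h2 := hmono (hmem x hx).1 hn1 (hmem x hx).2
      have h3 : Real.exp (-δ) ≤ 1 := Real.exp_le_one_iff.2 (by linarith)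
      exact (mul_le_of_le_one_right (hpos x (hmem x hx).1).le h3).trans h2
    -- By the choice of `j`, `j` drops multiply to at most `n ^ (-(d + 2))`; the exponent 2 pays for
    -- `c n ≤ n ^ 2`.
    · have h1 : (d + 2) * Real.log n ≤ j * δ := by
        rw [← div_le_iff₀ hδ]
        exact Nat.le_ceil _
      calc c n * Real.exp (-δ) ^ j ≤ (n : ℝ) ^ 2 * Real.exp (-((d + 2) * Real.log n)) := by
            rw [← Real.exp_nat_mul]
            gcongr
            linarith
        _ = (n : ℝ) ^ (2 : ℝ) * (n : ℝ) ^ (-(d + 2)) := by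
            rw [Real.rpow_def_of_pos hn0 (-(d + 2)), Real.rpow_ofNat]
            congr 2
            ring
        _ = ((n : ℝ) ^ d)⁻¹ := by
            rw [← Real.rpow_add hn0, ← Real.rpow_neg hn0.le]
            congr 1
            ring
  have hsplit : S.card ≤ a + (j + 1) * s := by
    have hsub : S ⊆ Finset.Icc 1 a ∪ S.filter (a < ·) := by
      intro k hk
      rw [Finset.mem_union, Finset.mem_Icc, Finset.mem_filter]
      by_cases hka : a < k
      · exact Or.inr ⟨hk, hka⟩
      · exact Or.inl ⟨(hS k hk).1, by omega⟩
    have := (Finset.card_le_card hsub).trans (Finset.card_union_le _ _)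
    rw [Nat.card_Icc] at this
    omega
  have hjle : (j : ℝ) ≤ (d + 2) * Real.log n / δ + 1 :=
    (Nat.ceil_lt_add_one (by positivity)).le
  calc (S.card : ℝ) ≤ a + (j + 1) * s := by exact_mod_cast hsplit
    _ ≤ a + ((d + 2) * Real.log n / δ + 2) * s := by
        refine add_le_add_right (mul_le_mul_of_nonneg_right ?_ (Nat.cast_nonneg s)) _
        linarith
    _ ≤ ε * n := has

end Loose

/-! ### Elementary limits. -/

section Asymptotics

theorem tendsto_log_natCast : Tendsto (fun n : ℕ => Real.log n) atTop atTop :=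
  Real.tendsto_log_atTop.comp tendsto_natCast_atTop_atTop

theorem tendsto_log_pow_div (p : ℕ) :
    Tendsto (fun n : ℕ => Real.log n ^ p / n) atTop (nhds 0) :=
  (Real.isLittleO_pow_log_id_atTop (n := p)).tendsto_div_nhds_zero.comp
    tendsto_natCast_atTop_atTop

theorem tendsto_log_div : Tendsto (fun n : ℕ => Real.log n / n) atTop (nhds 0) := by
  simpa using tendsto_log_pow_div 1

theorem tendsto_inv_natCast : Tendsto (fun n : ℕ => (n : ℝ)⁻¹) atTop (nhds 0) :=
  tendsto_inv_atTop_nhds_zero_nat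

theorem eventually_le_sq {c : ℕ → ℝ} {K : ℝ} (h : ∀ n : ℕ, 1 ≤ n → c n ≤ K * n) :
    ∀ᶠ n : ℕ in atTop, c n ≤ (n : ℝ) ^ 2 := by
  filter_upwards [eventually_ge_atTop 1, tendsto_natCast_atTop_atTop.eventually_ge_atTop K]
    with n hn hK
  calc c n ≤ K * n := h n hn
    _ ≤ n * n := by gcongr
    _ = (n : ℝ) ^ 2 := by ring

end Asymptotics

/-! ### Choice of the gap `s` and the rate `δ`. -/

section MainTheorems

variable {V : Type u} [DecidableEq V]

theorem PagingStrategy.Conservative.looselyCompetitive {X : PagingStrategy.{u, v} V}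
    (hX : X.Conservative) {c : ℕ → ℝ} (hpos : ∀ k, 1 ≤ k → 0 < c k)
    (hmono : MonotoneOn c (Set.Ici 1))
    (hdiv : MonotoneOn (fun k : ℕ => (k : ℝ) / c k) (Set.Ici 1))
    (hlim : Tendsto (fun k : ℕ => c k / Real.log k) atTop atTop) :
    X.LooselyCompetitive c := by
  have hlim' : Tendsto c atTop atTop := by
    refine (hlim.atTop_mul_atTop₀ tendsto_log_natCast).congr' ?_
    filter_upwards [tendsto_log_natCast.eventually_gt_atTop 0] with n hn
    field_simp
  refine looselyCompetitive_of_cost_le hpos hmono (eventually_le_sq (K := c 1) ?_) ?_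
  · intro n hn
    have h1 := hdiv (Set.mem_Ici.2 le_rfl) hn hn
    simp only [Nat.cast_one] at h1
    rw [div_le_div_iff₀ (hpos 1 le_rfl) (hpos n hn)] at h1
    linarith
  · intro d hd ε hε
    -- These four terms are the expansion of `((d + 2) * log n + 2) * (e * n / c n + 1) / n`, the
    -- bound on the proportion of bad values.
    have hT : Tendsto (fun n : ℕ => ((d + 2) * Real.exp 1) * (c n / Real.log n)⁻¹
        + 2 * Real.exp 1 * (c n)⁻¹ + (d + 2) * (Real.log n / n) + 2 * (n : ℝ)⁻¹)
        atTop (nhds 0) := by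
      simpa using (((hlim.inv_tendsto_atTop.const_mul ((d + 2) * Real.exp 1)).add
        (hlim'.inv_tendsto_atTop.const_mul (2 * Real.exp 1))).add
        (tendsto_log_div.const_mul (d + 2))).add (tendsto_inv_natCast.const_mul 2)
    filter_upwards [hT.eventually_lt_const hε, eventually_ge_atTop 1] with n hn hn1
    have hn0 : (0 : ℝ) < n := by exact_mod_cast hn1
    have hcn := hpos n hn1
    have hlog : 0 ≤ Real.log n := Real.log_natCast_nonneg n
    -- With this gap `k / (k + 1 - h) ≤ k * c n / (e * n) ≤ c k / e`, the last inequality by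
    -- monotonicity of `k / c k`; hence `δ = 1`.
    refine ⟨0, ⌈Real.exp 1 * n / c n⌉₊, 1, one_pos, ?_, ?_⟩
    · have h1 : ((⌈Real.exp 1 * n / c n⌉₊ : ℕ) : ℝ) ≤ Real.exp 1 * n / c n + 1 :=
        (Nat.ceil_lt_add_one (by positivity)).le
      calc _ ≤ ((0 : ℕ) : ℝ) + ((d + 2) * Real.log n / 1 + 2) * (Real.exp 1 * n / c n + 1) := by
            gcongr
        _ = (((d + 2) * Real.exp 1) * (c n / Real.log n)⁻¹
            + 2 * Real.exp 1 * (c n)⁻¹ + (d + 2) * (Real.log n / n) + 2 * (n : ℝ)⁻¹) * n := by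
            rw [inv_div]
            field_simp
            push_cast
            ring
        _ ≤ ε * n := by gcongr
    · intro k h hk hkn hh hhk r
      have hk0 : (0 : ℝ) < k := by exact_mod_cast hk
      have hck := hpos k hk
      refine (hX.cost_le hh (by omega) r).trans (ENNReal.ofReal_le_ofReal ?_)
      refine mul_le_mul_of_nonneg_right ?_ (by positivity)
      have h1 : Real.exp 1 * n / c n ≤ (k : ℝ) + 1 - h := by
        refine (Nat.le_ceil _).trans ?_
        have : (h : ℝ) + (⌈Real.exp 1 * n / c n⌉₊ : ℕ) ≤ k := by exact_mod_cast hhk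
        linarith
      have h2 : (k : ℝ) / c k ≤ n / c n := hdiv (Set.mem_Ici.2 hk) hn1 hkn
      have h3 : 0 < Real.exp 1 * n / c n := by positivity
      rw [div_le_iff₀ (by linarith)]
      calc (k : ℝ) = c k * (k / c k) := by field_simp
        _ ≤ c k * (n / c n) := by gcongr
        _ = c k * Real.exp (-1) * (Real.exp 1 * n / c n) := by
            rw [Real.exp_neg]
            field_simp
        _ ≤ _ := by gcongr

theorem mark_looselyCompetitive {c : ℕ → ℝ} (hpos : ∀ k, 1 ≤ k → 0 < c k)
    (hmono : MonotoneOn c (Set.Ici 1))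
    (hsub : MonotoneOn (fun k : ℕ => 2 * Real.log k - c k) (Set.Ici 1))
    (hlim : Tendsto (fun k : ℕ => c k - 2 * Real.log (Real.log k)) atTop atTop) :
    (mark V).LooselyCompetitive c := by
  have hloglog : Tendsto (fun n : ℕ => Real.log (Real.log n)) atTop atTop :=
    Real.tendsto_log_atTop.comp tendsto_log_natCast
  have hlim' : Tendsto c atTop atTop := by
    refine (hlim.atTop_add_atTop (hloglog.const_mul_atTop two_pos)).congr fun n => ?_
    ring
  have hcle : ∀ n : ℕ, 1 ≤ n → c n ≤ 2 * Real.log n + c 1 := by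
    intro n hn
    have h1 := hsub (Set.mem_Ici.2 le_rfl) hn hn
    simp only [Nat.cast_one, Real.log_one] at h1
    linarith
  refine looselyCompetitive_of_cost_le hpos hmono (eventually_le_sq (K := 2 + c 1) ?_) ?_
  · intro n hn
    have hn0 : (1 : ℝ) ≤ n := by exact_mod_cast hn
    have h1 := Real.log_le_sub_one_of_pos (x := n) (by linarith)
    have h2 := hcle n hn
    have h3 := hpos 1 le_rfl
    nlinarith
  · intro d hd ε hε
    have hexp : Tendsto (fun n : ℕ => Real.exp (-(c n / 2))) atTop (nhds 0) :=
      Real.tendsto_exp_neg_atTop_nhds_zero.comp (hlim'.atTop_div_const two_pos)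
    -- The expression is eventually `exp (-(c n - 2 * log (log n)) / 2)`; this is where the growth
    -- hypothesis on `c` enters.
    have hlogexp : Tendsto (fun n : ℕ => Real.log n * Real.exp (-(c n / 2))) atTop (nhds 0) := by
      refine (Real.tendsto_exp_neg_atTop_nhds_zero.comp
        (hlim.atTop_div_const two_pos)).congr' ?_
      filter_upwards [tendsto_log_natCast.eventually_gt_atTop 0] with n hn
      conv_rhs => rw [← Real.exp_log hn]
      rw [Function.comp_apply, ← Real.exp_add]
      congr 1
      ring
    have hclog : Tendsto (fun n : ℕ => c n * Real.log n / n) atTop (nhds 0) := by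
      have hT : Tendsto (fun n : ℕ => 2 * (Real.log n ^ 2 / n) + c 1 * (Real.log n / n))
          atTop (nhds 0) := by
        simpa using ((tendsto_log_pow_div 2).const_mul 2).add (tendsto_log_div.const_mul (c 1))
      refine tendsto_of_tendsto_of_tendsto_of_le_of_le' tendsto_const_nhds hT ?_ ?_
      · filter_upwards [eventually_ge_atTop 1] with n hn
        have := (hpos n hn).le
        have hlog : 0 ≤ Real.log n := Real.log_natCast_nonneg n
        positivity
      · filter_upwards [eventually_ge_atTop 1] with n hn
        have hlog : 0 ≤ Real.log n := Real.log_natCast_nonneg n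
        calc c n * Real.log n / n ≤ (2 * Real.log n + c 1) * Real.log n / n := by
              gcongr
              exact hcle n hn
          _ = _ := by ring
    have hT : Tendsto (fun n : ℕ =>
        (d + 2) * (4 * Real.exp (1 / 2)) * (Real.log n * Real.exp (-(c n / 2)))
        + 8 * Real.exp (1 / 2) * (Real.exp (-(c n / 2)) * (c n)⁻¹)
        + (d + 2) * (c n * Real.log n / n) + 2 * (n : ℝ)⁻¹) atTop (nhds 0) := by
      simpa using (((hlogexp.const_mul ((d + 2) * (4 * Real.exp (1 / 2)))).add
        ((hexp.mul hlim'.inv_tendsto_atTop).const_mul (8 * Real.exp (1 / 2)))).add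
        (hclog.const_mul (d + 2))).add (tendsto_inv_natCast.const_mul 2)
    filter_upwards [hT.eventually_lt_const (half_pos hε), eventually_ge_atTop 1,
      -- For `k > ε * n / 2`, `hsub` gives `c k ≥ c n + 2 * log (ε / 2)`; this threshold turns that
      -- into `c k - 1 ≥ c n / 2`.
      hlim'.eventually_ge_atTop (2 * (1 - 2 * Real.log (ε / 2))),
      hlim'.eventually_gt_atTop 0] with n hn hn1 hc1 hcn
    have hn0 : (0 : ℝ) < n := by exact_mod_cast hn1
    have hlog : 0 ≤ Real.log n := Real.log_natCast_nonneg n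
    -- The gap is tuned to `ρ = (c k - 1) / 2`. Since `ρ ≥ c n / 4`, one has `ρ * exp ρ * σ ≥ n *
    -- exp ((c k - c n) / 2)`, which is at least `k` by `hsub`.
    set σ := 4 * Real.exp (1 / 2) * n * Real.exp (-(c n / 2)) / c n with hσ
    have hσ0 : 0 < σ := by positivity
    refine ⟨⌊ε / 2 * n⌋₊, ⌈σ⌉₊, 1 / c n, by positivity, ?_, ?_⟩
    · have h1 : (⌈σ⌉₊ : ℝ) ≤ σ + 1 := (Nat.ceil_lt_add_one hσ0.le).le
      have h2 : (⌊ε / 2 * n⌋₊ : ℝ) ≤ ε / 2 * n := Nat.floor_le (by positivity)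
      calc _ ≤ ε / 2 * n + ((d + 2) * Real.log n / (1 / c n) + 2) * (σ + 1) := by
            gcongr
        _ = ε / 2 * n
            + ((d + 2) * (4 * Real.exp (1 / 2)) * (Real.log n * Real.exp (-(c n / 2)))
              + 8 * Real.exp (1 / 2) * (Real.exp (-(c n / 2)) * (c n)⁻¹)
              + (d + 2) * (c n * Real.log n / n) + 2 * (n : ℝ)⁻¹) * n := by
            rw [hσ]
            field_simp
            ring
        _ ≤ ε / 2 * n + ε / 2 * n := by gcongr
        _ = ε * n := by ring
    · intro k h hk hkn hh hhk r
      have hk1 : 1 ≤ k := by omega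
      have hk0 : (0 : ℝ) < k := by exact_mod_cast hk1
      have hck := hpos k hk1
      have hkε : ε / 2 * n < k := (Nat.floor_lt (by positivity)).1 hk
      have hlogk : Real.log (ε / 2) + Real.log n ≤ Real.log k := by
        rw [← Real.log_mul (by positivity) hn0.ne']
        exact Real.log_le_log (by positivity) hkε.le
      have h1 : 2 * Real.log k - c k ≤ 2 * Real.log n - c n := hsub hk1 hn1 hkn
      have h2 : c n / 2 ≤ c k - 1 := by linarith
      have h3 : c k ≤ c n := hmono hk1 hn1 hkn
      have hρ0 : 0 < (c k - 1) / 2 := by linarith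
      have hs : σ ≤ (k : ℝ) - h := by
        refine (Nat.le_ceil _).trans ?_
        have : (h : ℝ) + (⌈σ⌉₊ : ℕ) ≤ k := by exact_mod_cast hhk
        linarith
      have hρ : (k : ℝ) ≤ (c k - 1) / 2 * Real.exp ((c k - 1) / 2) * ((k : ℝ) - h) := by
        have h4 : (k : ℝ) ≤ n * Real.exp (-(c n / 2)) * Real.exp (c k / 2) := by
          calc (k : ℝ) = Real.exp (Real.log k) := (Real.exp_log hk0).symm
            _ ≤ Real.exp (Real.log n + -(c n / 2) + c k / 2) := by
                apply Real.exp_le_exp.2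
                linarith
            _ = _ := by rw [Real.exp_add, Real.exp_add, Real.exp_log hn0]
        calc (k : ℝ) ≤ n * Real.exp (-(c n / 2)) * Real.exp (c k / 2) := h4
          _ = n * Real.exp (-(c n / 2)) * (Real.exp ((c k - 1) / 2) * Real.exp (1 / 2)) := by
              rw [← Real.exp_add]
              ring_nf
          _ = c n / 4 * Real.exp ((c k - 1) / 2) * σ := by
              rw [hσ]
              field_simp
          _ ≤ (c k - 1) / 2 * Real.exp ((c k - 1) / 2) * ((k : ℝ) - h) := by
              have h5 : c n / 4 ≤ (c k - 1) / 2 := by linarith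
              gcongr
      refine (mark_cost_le hh (by omega) hρ0 hρ r).trans (ENNReal.ofReal_le_ofReal ?_)
      refine mul_le_mul_of_nonneg_right ?_ (by positivity)
      -- The factor `2 * ρ` equals `c k * (1 - 1 / c k)`; the unit subtracted in `ρ` is what yields
      -- the decay rate `δ = 1 / c n`.
      have h5 := Real.add_one_le_exp (-(1 / c k))
      have h6 : Real.exp (-(1 / c k)) ≤ Real.exp (-(1 / c n)) := by
        apply Real.exp_le_exp.2
        exact neg_le_neg (one_div_le_one_div_of_le hck h3)
      calc 2 * ((c k - 1) / 2) = c k * (-(1 / c k) + 1) := by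
            field_simp
            ring
        _ ≤ c k * Real.exp (-(1 / c n)) := by
            gcongr
            exact h5.trans h6

end MainTheorems

end Paging

theorem mainTheorem2 {V : Type u} [DecidableEq V] (c : ℕ → ℝ)
    (hpos : ∀ k, 1 ≤ k → 0 < c k) (hmono : MonotoneOn c (Set.Ici 1)) :
    (MonotoneOn (fun k : ℕ => (k : ℝ) / c k) (Set.Ici 1) →
      Tendsto (fun k : ℕ => c k / Real.log k) atTop atTop →
      ∀ X : Paging.PagingStrategy.{u, v} V, X.Conservative → X.LooselyCompetitive c) ∧
    ((Paging.lru V).Conservative ∧ (Paging.fifo V).Conservative ∧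
      (Paging.fwf V).Conservative) ∧
    (MonotoneOn (fun k : ℕ => 2 * Real.log k - c k) (Set.Ici 1) →
      Tendsto (fun k : ℕ => c k - 2 * Real.log (Real.log k)) atTop atTop →
      (Paging.mark V).LooselyCompetitive c) :=
  ⟨fun hdiv hlim _ hX => hX.looselyCompetitive hpos hmono hdiv hlim,
    ⟨Paging.lru_conservative, Paging.fifo_conservative, Paging.fwf_conservative⟩,
    fun hsub hlim => Paging.mark_looselyCompetitive hpos hmono hsub hlim⟩
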